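/- Let $N\ge 1$ and let $\rho:\mathbb{R}^3\to\mathbb{R}$ satisfy $\rho\ge 0$, $\sqrt{\rho}\in H^1(\mathbb{R}^3)$ and $\int_{\mathbb{R}^3}\rho\,dx=N$. Let $\mathcal{A}_N$ be the set of all $\Psi\in L^2((\mathbb{R}^3\times\mathbb{Z}_2)^N;\mathbb{C})$ with weak gradient $\nabla\Psi\in L^2$ (with respect to the position variables), $\|\Psi\|_{L^2}=1$, and $\Psi(z_{\sigma(1)},\dots,z_{\sigma(N)})=\mathrm{sgn}(\sigma)\,\Psi(z_1,\dots,z_N)$ for all permutations $\sigma$, where $z_i=(x_i,s_i)\in\mathbb{R}^3\times\mathbb{Z}_2$. Write $\Psi\mapsto\rho$ if $$N\int_{\mathbb{R}^{3(N-1)}}\sum_{s_1,\dots,s_N\in\mathbb{Z}_2}|\Psi(x_1,s_1,\dots,x_N,s_N)|^2\,dx_2\cdots dx_N=\rho(x_1)\quad\text{for a.e. }x_1\in\mathbb{R}^3 .$$ For $\alpha>0$ define the fermionic Hohenberg–Kohn functional $$F^{HK}_\alpha[\rho]=\inf_{\Psi\in\mathcal{A}_N,\ \Psi\mapsto\rho}\bigl\{\alpha\,T[\Psi]+V_{ee}[\Psi]\bigr\},$$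 where $$T[\Psi]=\int_{\mathbb{R}^{3N}}\sum_{s_1,\dots,s_N}\sum_{i=1}^N|\nabla_{x_i}\Psi|^2\,dx_1\cdots dx_N,\qquad V_{ee}[\Psi]=\int_{\mathbb{R}^{3N}}\sum_{s_1,\dots,s_N}\sum_{1\le i<j\le N}\frac{|\Psi|^2}{|x_i-x_j|}\,dx_1\cdots dx_N .$$ Define the SCE functional as the optimal cost of the symmetric multi-marginal optimal transport problem with Coulomb cost and marginals $\rho/N$, $$V^{SCE}_{ee}[\rho]=\inf_{\gamma}\int_{\mathbb{R}^{3N}}\sum_{1\le i<j\le N}\frac{1}{|x_i-x_j|}\,d\gamma(x_1,\dots,x_N),$$ where the infimum is over all Borel probability measures $\gamma$ on $\mathbb{R}^{3N}$ such that $\gamma(A_1\times\cdots\times A_N)=\gamma(A_{\sigma(1)}\times\cdots\times A_{\sigma(N)})$ for all Borel sets $A_1,\dots,A_N\subseteq\mathbb{R}^3$ and all permutations $\sigma$, and $\gamma(A\times\mathbb{R}^{3(N-1)})=\int_A\frac{\rho(x)}{N}\,dx$ for all Borel $A\subseteq\mathbb{R}^3$ (with $1/0=+\infty$ in the cost). Then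 $V^{SCE}_{ee}[\rho]$ is finite and $$\lim_{\alpha\downarrow 0}F^{HK}_\alpha[\rho]=V^{SCE}_{ee}[\rho].$$ -/

import Mathlib

open MeasureTheory Filter Topology
open scoped ENNReal ContDiff

noncomputable section

/-- Physical space `ℝ³` with its Euclidean norm. -/
abbrev R3 : Type := EuclideanSpace ℝ (Fin 3)

/-- Position configurations `(x₁, …, x_N) ∈ ℝ^{3N}` (with Lebesgue measure as `volume`). -/
abbrev Config (N : ℕ) : Type := Fin N → R3

/-- Spin configurations `(s₁, …, s_N) ∈ ℤ₂^N`. -/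
abbrev Spins (N : ℕ) : Type := Fin N → ZMod 2

/-! ### Weak derivatives and the Sobolev space `H¹` -/

section Sobolev

variable {X F : Type*} [NormedAddCommGroup X] [NormedSpace ℝ X] [MeasureSpace X]
  [NormedAddCommGroup F] [NormedSpace ℝ F]

/-- `g` is the weak (distributional) derivative of `u` in the direction `v`:
`∫ (∂_v φ) u = - ∫ φ g` for all real test functions `φ ∈ C_c^∞`. -/
def HasWeakDeriv (v : X) (u g : X → F) : Prop :=
  ∀ φ : X → ℝ, ContDiff ℝ ∞ φ → HasCompactSupport φ →
    ∫ x, (fderiv ℝ φ x v) • u x = - ∫ x, φ x • g x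

/-- `u ∈ H¹`: `u ∈ L²`, and in every direction `u` has a weak derivative in `L²`. -/
def MemH1 (u : X → F) : Prop :=
  MemLp u 2 volume ∧ ∀ v : X, ∃ g : X → F, MemLp g 2 volume ∧ HasWeakDeriv v u g

open scoped Classical in
/-- The weak derivative `∂_v u ∈ L²` (unique up to null sets, see `HasWeakDeriv.ae_unique`);
set to `0` if there is none. -/
def weakDeriv (v : X) (u : X → F) : X → F :=
  if h : ∃ g : X → F, MemLp g 2 volume ∧ HasWeakDeriv v u g then h.choose else 0

theorem HasWeakDeriv.ae_unique [FiniteDimensional ℝ X] [BorelSpace X] [CompleteSpace F]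
    [IsLocallyFiniteMeasure (volume : Measure X)]
    {v : X} {u g g' : X → F} (hg : MemLp g 2 volume) (hg' : MemLp g' 2 volume)
    (h : HasWeakDeriv v u g) (h' : HasWeakDeriv v u g') : g =ᵐ[volume] g' := by
  refine ae_eq_of_integral_contDiff_smul_eq (hg.locallyIntegrable (by norm_num))
    (hg'.locallyIntegrable (by norm_num)) fun φ hφ hc => ?_
  have := (h φ hφ hc).symm.trans (h' φ hφ hc)
  exact neg_injective this

end Sobolev

/-! ### Wavefunctions -/

/-- `N`-electron wavefunctions `Ψ(x₁, s₁, …, x_N, s_N)`, written `Ψ s x`. -/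
abbrev Wavefunction (N : ℕ) : Type := Spins N → Config N → ℂ

/-- `Ψ(z_{σ(1)}, …, z_{σ(N)}) = sgn(σ) Ψ(z₁, …, z_N)` for all permutations `σ`
(almost everywhere, as `Ψ` is an element of `L²`). -/
def Antisymmetric {N : ℕ} (Ψ : Wavefunction N) : Prop :=
  ∀ (σ : Equiv.Perm (Fin N)) (s : Spins N), ∀ᵐ x : Config N,
    Ψ (fun i => s (σ i)) (fun i => x (σ i)) = ((Equiv.Perm.sign σ : ℤ) : ℂ) * Ψ s x

/-- The `N`-body position density `ρ_N^Ψ(x) = ∑_s |Ψ(x, s)|²`. -/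
def positionDensity {N : ℕ} (Ψ : Wavefunction N) (x : Config N) : ℝ≥0∞ :=
  ∑ s : Spins N, ‖Ψ s x‖ₑ ^ 2

/-- The admissible class `𝒜_N`: antisymmetric wavefunctions in `H¹` with `‖Ψ‖_{L²} = 1`. -/
structure Admissible {N : ℕ} (Ψ : Wavefunction N) : Prop where
  memH1 : ∀ s, MemH1 (Ψ s)
  antisymm : Antisymmetric Ψ
  norm_eq_one : ∫⁻ x, positionDensity Ψ x = 1

/-- The one-body density of an `N`-electron wavefunction, `N = n + 1`:
`ρ^Ψ(x₁) = N ∫ ∑_s |Ψ(x₁, s₁, …, x_N, s_N)|² dx₂ ⋯ dx_N`. -/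
def oneBodyDensity {n : ℕ} (Ψ : Wavefunction (n + 1)) (x₁ : R3) : ℝ≥0∞ :=
  (n + 1 : ℕ) * ∫⁻ y : Config n, positionDensity Ψ (Fin.cons x₁ y)

/-- `Ψ ↦ ρ`: the one-body density of `Ψ` is `ρ` (as integrable functions). -/
def HasDensity {n : ℕ} (Ψ : Wavefunction (n + 1)) (ρ : R3 → ℝ) : Prop :=
  oneBodyDensity Ψ =ᵐ[volume] fun x => ENNReal.ofReal (ρ x)

/-! ### Energies -/

/-- The Coulomb cost `∑_{i<j} 1 / |x_i - x_j|`, with value `∞` when two positions coincide. -/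
def coulomb {N : ℕ} (x : Config N) : ℝ≥0∞ :=
  ∑ i : Fin N, ∑ j ∈ Finset.Ioi i, ‖x i - x j‖ₑ⁻¹

/-- The kinetic energy `T[Ψ] = ∫ ∑_s ∑_i |∇_{x_i} Ψ|²`. -/
def kinetic {N : ℕ} (Ψ : Wavefunction N) : ℝ≥0∞ :=
  ∫⁻ x, ∑ s : Spins N, ∑ i : Fin N, ∑ k : Fin 3,
    ‖weakDeriv (Pi.single i (EuclideanSpace.single k (1 : ℝ)) : Config N) (Ψ s) x‖ₑ ^ 2

/-- The electron-electron interaction energy `V_ee[Ψ] = ∫ ∑_s ∑_{i<j} |Ψ|² / |x_i - x_j|`. -/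
def interaction {N : ℕ} (Ψ : Wavefunction N) : ℝ≥0∞ :=
  ∫⁻ x, coulomb x * positionDensity Ψ x

/-- The Hohenberg-Kohn functional for `N = n + 1` electrons:
`F_α^HK[ρ] = inf {α T[Ψ] + V_ee[Ψ] | Ψ ∈ 𝒜_N, Ψ ↦ ρ}`. -/
def hohenbergKohn (n : ℕ) (α : ℝ) (ρ : R3 → ℝ) : ℝ≥0∞ :=
  ⨅ Ψ : {Ψ : Wavefunction (n + 1) // Admissible Ψ ∧ HasDensity Ψ ρ},
    ENNReal.ofReal α * kinetic Ψ.1 + interaction Ψ.1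

/-! ### The optimal transport problem -/

/-- Symmetric Borel probability measures on `ℝ^{3N}`. -/
structure IsSymmProb {N : ℕ} (γ : Measure (Config N)) : Prop where
  prob : IsProbabilityMeasure γ
  symm : ∀ (σ : Equiv.Perm (Fin N)) (A : Fin N → Set R3), (∀ i, MeasurableSet (A i)) →
    γ (Set.univ.pi A) = γ (Set.univ.pi fun i => A (σ i))

/-- `γ ↦ ρ / N` with `N = n + 1`: `γ(A × ℝ^{3(N-1)}) = ∫_A ρ(x) / N dx` for all Borel `A`. -/
def HasMarginal {n : ℕ} (γ : Measure (Config (n + 1))) (ρ : R3 → ℝ) : Prop :=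
  ∀ A : Set R3, MeasurableSet A →
    γ {x | x 0 ∈ A} = ∫⁻ x in A, ENNReal.ofReal (ρ x / (n + 1 : ℕ))

/-- The SCE functional for `N = n + 1` electrons: the infimum of the Coulomb cost over all
symmetric plans `γ ↦ ρ / N`. -/
def sceFunctional (n : ℕ) (ρ : R3 → ℝ) : ℝ≥0∞ :=
  ⨅ γ : {γ : Measure (Config (n + 1)) // IsSymmProb γ ∧ HasMarginal γ ρ},
    ∫⁻ x, coulomb x ∂γ.1

/-- The density class `ℛ_N`, `N = n + 1`: `ρ ≥ 0`, `√ρ ∈ H¹(ℝ³)`, `∫ ρ = N`. -/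
structure IsDensity (n : ℕ) (ρ : R3 → ℝ) : Prop where
  nonneg : 0 ≤ᵐ[volume] ρ
  sqrt_memH1 : MemH1 fun x => Real.sqrt (ρ x)
  integral_eq : ∫ x, ρ x = (n + 1 : ℕ)

end

set_option linter.unusedSectionVars false

/-! Lower bound. For an admissible `Ψ` with density `ρ`, the measure with density `positionDensity
Ψ` is a symmetric plan with marginal `ρ / N` and its cost is the interaction energy of `Ψ`
(`sceFunctional_le_interaction`). Kinetic energy is nonnegative, so the SCE value bounds the
Hohenberg–Kohn functional from below for every `α`.

Upper bound. It suffices to find, for each `ε`, one admissible `Ψ` with density exactly `ρ` and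
interaction at most SCE `+ ε`: its kinetic energy is finite, so `α T[Ψ]` vanishes in the limit
(`tendsto_hohenbergKohn`). Write `u = √ρ` and let `γ` be a nearly optimal plan.

Bulk (`exists_bulk_slot`). Cover most of the mass by small disjoint compact sets `K_j`, with
Lipschitz bumps `χ_j` of disjoint supports, and normalize `χ_j u` to orbitals `φ_j`. Superpose the
products `∏ φ_{k_i}(x_i)` with antisymmetric signs and amplitudes the square roots of slightly
reduced masses `γ(K_{k_1} × ⋯ × K_{k_N})`, keeping only labellings with well separated boxes.
Disjoint supports remove all cross terms (`IsSlot.slot_sq`), so the squared state is a smoothing of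
most of `γ` at a scale where the Coulomb cost is nearly constant. Its one-body density is `(1 - η²)
u²` with `η` Lipschitz.

Remainder (`exists_remainder_slots`). The missing density `η² u²`, of small mass, is produced
exactly by orbitals `√(2N) arch(G - shift) U`, where `U²` is the normalized remainder and `G` pushes
it to the uniform law on `(0, 1]`. The shifted arches in one family have disjoint supports, and two
families, shifted by half an arch, add up through `sin² + cos² = 1` (`exists_arch_slots`). The `L²`
Lipschitz bound on translates of `u` controls the mass of small balls, hence Coulomb potentials
(`exists_potential_le`), and makes the energy of the remainder small.

Gluing (`exists_wave_of_slots`). Bulk and two remainder states become one wavefunction without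
interference: one sits on all spins up, the other two are real and imaginary parts on all spins
down.

Throughout, `H¹` regularity is handled as Lipschitz continuity of translates in `L²`, which is
stable under tensor products, sums and multiplication by bounded Lipschitz functions. -/

noncomputable section

/-! ### `H¹` and Lipschitz continuity of translations in `L²` -/

section Translates

variable {E F : Type*} [NormedAddCommGroup E] [NormedSpace ℝ E] [MeasureSpace E]
  [NormedAddCommGroup F]

/-- The translates of `u` in direction `v` are Lipschitz in `L²`. -/
def LipTranslates (v : E) (u : E → F) : Prop :=
  ∃ C : NNReal, ∀ t : ℝ, eLpNorm (fun x => u (x + t • v) - u x) 2 volume ≤ C * ‖t‖ₑ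

end Translates

theorem MeasureTheory.MemLp.comp_translate {E F : Type*} [NormedAddCommGroup E] [MeasureSpace E]
    [BorelSpace E] [(volume : Measure E).IsAddHaarMeasure] [NormedAddCommGroup F] {u : E → F}
    {p : ℝ≥0∞} (hu : MemLp u p volume) (a : E) : MemLp (fun x => u (x + a)) p volume :=
  hu.comp_measurePreserving (measurePreserving_add_right volume a)

section Equivalence

variable {E : Type*} [NormedAddCommGroup E] [NormedSpace ℝ E] [FiniteDimensional ℝ E]
  [MeasureSpace E] [BorelSpace E] [(volume : Measure E).IsAddHaarMeasure]

theorem abs_integral_mul_le {α : Type*} [MeasurableSpace α] {μ : Measure α} {f g : α → ℝ}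
    (hf : MemLp f 2 μ) (hg : MemLp g 2 μ) :
    |∫ x, f x * g x ∂μ| ≤ (eLpNorm f 2 μ).toReal * (eLpNorm g 2 μ).toReal := by
  have h := abs_real_inner_le_norm (hg.toLp g) (hf.toLp f)
  rw [L2.inner_def, Lp.norm_toLp, Lp.norm_toLp] at h
  have e : ∫ x, inner ℝ ((hg.toLp g) x) ((hf.toLp f) x) ∂μ = ∫ x, f x * g x ∂μ := by
    refine integral_congr_ae ?_
    filter_upwards [hf.coeFn_toLp, hg.coeFn_toLp] with x h1 h2
    simp [h1, h2]
  rw [e] at h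
  linarith

/-- Differentiation under the integral sign of the translates of a test function. -/
theorem hasDerivAt_integral_translate_smul {F : Type*} [NormedAddCommGroup F] [NormedSpace ℝ F]
    {φ : E → ℝ} (hφ : ContDiff ℝ ∞ φ) (hc : HasCompactSupport φ) {u : E → F}
    (hu : MemLp u 2 volume) (v : E) :
    HasDerivAt (fun s : ℝ => ∫ x, φ (x - s • v) • u x)
      (- ∫ x, (fderiv ℝ φ x v) • u x) 0 := by
  have hφd : Differentiable ℝ φ := hφ.differentiable (by simp)
  have hfc : Continuous fun x => fderiv ℝ φ x v :=
    (hφ.continuous_fderiv (by simp)).clm_apply continuous_const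
  have hfs : HasCompactSupport fun x => fderiv ℝ φ x v := hc.fderiv_apply ℝ v
  obtain ⟨M, hM⟩ := hfs.exists_bound_of_continuous hfc
  -- For every `|s| ≤ 1`, the support of `φ(· - s v)` lies in this compact set, where `u` is
  -- integrable; this gives the dominating function.
  set K : Set E := (fun p : E × ℝ => p.1 + p.2 • v) '' (tsupport φ ×ˢ Metric.closedBall 0 1)
  have hK : IsCompact K :=
    (hc.prod (isCompact_closedBall 0 1)).image (by fun_prop)
  have huK : IntegrableOn u K := (hu.locallyIntegrable (by norm_num)).integrableOn_isCompact hK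
  have key := hasDerivAt_integral_of_dominated_loc_of_deriv_le (μ := (volume : Measure E))
    (F := fun (s : ℝ) x => φ (x - s • v) • u x)
    (F' := fun (s : ℝ) x => -((fderiv ℝ φ (x - s • v) v) • u x)) (x₀ := (0 : ℝ))
    (s := Metric.ball 0 1)
    (bound := K.indicator fun x => M * ‖u x‖) (Metric.ball_mem_nhds _ one_pos)
    (Eventually.of_forall fun s => ?_) ?_ ?_ (Eventually.of_forall fun x s hs => ?_) ?_
    (Eventually.of_forall fun x s hs => ?_)
  · simpa [integral_neg] using key.2
  · exact (hφ.continuous.comp (by fun_prop)).aestronglyMeasurable.smul hu.aestronglyMeasurable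
  · simp only [zero_smul, sub_zero]
    exact ((hu.locallyIntegrable (by norm_num)).integrable_smul_left_of_hasCompactSupport
      hφ.continuous hc)
  · exact ((hfc.comp (by fun_prop)).aestronglyMeasurable.smul hu.aestronglyMeasurable).neg
  · by_cases hx : x ∈ K
    · rw [Set.indicator_of_mem hx, norm_neg, norm_smul]
      exact mul_le_mul_of_nonneg_right (hM _) (norm_nonneg _)
    · have : fderiv ℝ φ (x - s • v) = 0 := by
        by_contra h
        refine hx ⟨(x - s • v, s), ⟨support_fderiv_subset ℝ h, ?_⟩, by simp⟩
        exact Metric.ball_subset_closedBall hs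
      simp [this, Set.indicator_of_notMem hx]
  · exact (integrable_indicator_iff hK.measurableSet).2 (huK.norm.const_mul M)
  · have h1 : HasDerivAt (fun s : ℝ => x - s • v) (-v) s := by
      simpa using ((hasDerivAt_id s).smul_const v).const_sub x
    have := ((hφd (x - s • v)).hasFDerivAt.comp_hasDerivAt s h1).smul_const (u x)
    simpa using this

/-- Duality: the bound is a closed condition on the test element, so it passes from the dense test
functions to all of `L²`; then it is tested on `w` itself. -/
theorem eLpNorm_le_of_forall_integral_le {w : E → ℝ} (hw : MemLp w 2 volume) {c : ℝ} (hc0 : 0 ≤ c)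
    (h : ∀ φ : E → ℝ, ContDiff ℝ ∞ φ → HasCompactSupport φ →
      |∫ x, φ x * w x| ≤ c * (eLpNorm φ 2 volume).toReal) :
    eLpNorm w 2 volume ≤ ENNReal.ofReal c := by
  have hd := Lp.dense_hasCompactSupport_contDiff (F := ℝ) (μ := (volume : Measure E)) (p := 2)
    (by norm_num)
  have hcl : IsClosed {f : Lp ℝ 2 (volume : Measure E) | inner ℝ f (hw.toLp w) ≤ c * ‖f‖} :=
    isClosed_le (by fun_prop) (by fun_prop)
  have hall : ∀ f : Lp ℝ 2 (volume : Measure E), inner ℝ f (hw.toLp w) ≤ c * ‖f‖ := by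
    intro f
    refine closure_minimal ?_ hcl (hd f)
    rintro f ⟨φ, hfφ, hc, hφ⟩
    have e : inner ℝ f (hw.toLp w) = ∫ x, φ x * w x := by
      rw [L2.inner_def]
      refine integral_congr_ae ?_
      filter_upwards [hfφ, hw.coeFn_toLp] with x h1 h2
      simp [h1, h2, mul_comm]
    rw [Set.mem_ofPred_eq, e, Lp.norm_def, eLpNorm_congr_ae hfφ]
    exact (le_abs_self _).trans (h φ hφ hc)
  have h1 := hall (hw.toLp w)
  rw [real_inner_self_eq_norm_sq, Lp.norm_toLp] at h1
  refine (ENNReal.le_ofReal_iff_toReal_le hw.eLpNorm_ne_top ?_).2 ?_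
  · exact hc0
  · by_contra! hlt
    nlinarith [hc0.trans_lt hlt]

/-- A function with an `L²` weak derivative has Lipschitz translates. -/
theorem HasWeakDeriv.lipTranslates {u g : E → ℝ} {v : E} (hu : MemLp u 2 volume)
    (hg : MemLp g 2 volume) (h : HasWeakDeriv v u g) : LipTranslates v u := by
  refine ⟨(eLpNorm g 2 volume).toNNReal, fun t => ?_⟩
  have hw : MemLp (fun x => u (x + t • v) - u x) 2 volume := (hu.comp_translate (t • v)).sub hu
  have hE : ((eLpNorm g 2 volume).toNNReal : ℝ≥0∞) * ‖t‖ₑ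
      = ENNReal.ofReal ((eLpNorm g 2 volume).toReal * |t|) := by
    rw [ENNReal.coe_toNNReal hg.eLpNorm_ne_top, ENNReal.ofReal_mul ENNReal.toReal_nonneg,
      ENNReal.ofReal_toReal hg.eLpNorm_ne_top, Real.enorm_eq_ofReal_abs]
  rw [hE]
  refine eLpNorm_le_of_forall_integral_le hw (by positivity) fun φ hφ hc => ?_
  have hφ2 : MemLp φ 2 volume := hφ.continuous.memLp_of_hasCompactSupport hc
  -- Moving the translation onto `φ` makes the pairing a differentiable function of `s` with
  -- derivative `∫ φ(x - s v) g`, bounded by `‖φ‖ ‖g‖`. The mean value inequality then bounds `m t -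
  -- m 0`.
  set m : ℝ → ℝ := fun s => ∫ x, φ (x - s • v) • u x with hm
  have hsmooth : ∀ s : ℝ, ContDiff ℝ ∞ (fun x => φ (x - s • v)) := fun s =>
    hφ.comp (contDiff_id.sub contDiff_const)
  have hsupp : ∀ s : ℝ, HasCompactSupport (fun x => φ (x - s • v)) := fun s => by
    simpa [sub_eq_add_neg, Function.comp_def] using
      hc.comp_homeomorph (Homeomorph.addRight (-(s • v)))
  have hder : ∀ s, HasDerivAt m (∫ x, φ (x - s • v) * g x) s := by
    intro s
    have h1 := hasDerivAt_integral_translate_smul (hsmooth s) (hsupp s) hu v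
    rw [h _ (hsmooth s) (hsupp s), neg_neg] at h1
    have h2 : HasDerivAt (fun r : ℝ => r - s) 1 s := (hasDerivAt_id s).sub_const s
    have h3 := HasDerivAt.scomp s (by simpa using h1) h2
    simp only [smul_eq_mul, one_mul] at h3
    refine h3.congr_of_eventuallyEq (Eventually.of_forall fun r => ?_)
    simp only [hm, Function.comp, smul_eq_mul]
    congr 1; ext x; congr 2
    rw [sub_smul]; abel
  have hbound : ∀ s : ℝ, ‖∫ x, φ (x - s • v) * g x‖
      ≤ (eLpNorm φ 2 volume).toReal * (eLpNorm g 2 volume).toReal := by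
    intro s
    have hps : MemLp (fun x => φ (x - s • v)) 2 volume := by
      simpa [sub_eq_add_neg] using hφ2.comp_translate (-(s • v))
    have hn : eLpNorm (fun x => φ (x - s • v)) 2 volume = eLpNorm φ 2 volume :=
      eLpNorm_comp_measurePreserving hφ2.aestronglyMeasurable
        (measurePreserving_sub_right volume (s • v))
    have := abs_integral_mul_le hps hg
    rwa [hn] at this
  have hmv := Convex.norm_image_sub_le_of_norm_hasDerivWithin_le
    (fun s _ => (hder s).hasDerivWithinAt) (fun s _ => hbound s) convex_univ
    (Set.mem_univ (0 : ℝ)) (Set.mem_univ t)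
  have e : ∫ x, φ x * (u (x + t • v) - u x) = m t - m 0 := by
    have h1 : m t = ∫ x, φ x * u (x + t • v) := by
      rw [hm]
      refine (integral_add_right_eq_self (fun x => φ (x - t • v) • u x) (t • v)).symm.trans ?_
      simp
    rw [h1, hm]
    simp only [zero_smul, sub_zero, smul_eq_mul]
    rw [← integral_sub]
    · simp_rw [mul_sub]
    · exact hφ2.integrable_mul (hu.comp_translate _)
    · exact hφ2.integrable_mul hu
  rw [e]
  calc _ ≤ _ := hmv
    _ = _ := by rw [sub_zero, Real.norm_eq_abs]; ring

/-- An `L²` function with Lipschitz translates has an `L²` weak derivative. -/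
theorem LipTranslates.exists_hasWeakDeriv {u : E → ℂ} {v : E} (hu : MemLp u 2 volume)
    (h : LipTranslates v u) : ∃ g : E → ℂ, MemLp g 2 volume ∧ HasWeakDeriv v u g := by
  obtain ⟨C, hC⟩ := h
  have hq : ∀ t : ℝ, MemLp (fun x => (t : ℂ)⁻¹ • (u (x + t • v) - u x)) 2 volume := fun t =>
    ((hu.comp_translate (t • v)).sub hu).const_smul ((t : ℂ)⁻¹)
  set q : ℝ → Lp ℂ 2 (volume : Measure E) := fun t => (hq t).toLp with hqdef
  have hqn : ∀ t : ℝ, t ≠ 0 → ‖q t‖ ≤ C := by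
    intro t ht
    rw [hqdef, Lp.norm_toLp]
    refine ENNReal.toReal_le_coe_of_le_coe ?_
    calc eLpNorm (fun x => (t : ℂ)⁻¹ • (u (x + t • v) - u x)) 2 volume
        = ‖(t : ℂ)⁻¹‖ₑ * eLpNorm (fun x => u (x + t • v) - u x) 2 volume :=
          eLpNorm_const_smul ((t : ℂ)⁻¹) (fun x => u (x + t • v) - u x) 2 volume
      _ ≤ ‖(t : ℂ)⁻¹‖ₑ * (C * ‖t‖ₑ) := by gcongr; exact hC t
      _ = C * (‖(t : ℂ)⁻¹‖ₑ * ‖(t : ℂ)‖ₑ) := by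
          rw [show ‖(t : ℂ)‖ₑ = ‖t‖ₑ by simp [enorm_eq_nnnorm]]; ring
      _ = C := by
          rw [← enorm_mul, inv_mul_cancel₀ (by exact_mod_cast ht)]; simp
  -- The difference quotients are bounded in `L²`, so by Banach–Alaoglu they have a weak-* cluster
  -- point as `t → 0`. Its Riesz representative is the candidate derivative.
  set Q : ℝ → WeakDual ℂ (Lp ℂ 2 (volume : Measure E)) := fun t =>
    StrongDual.toWeakDual (InnerProductSpace.toDual ℂ _ (q t)) with hQ
  have hcomp := WeakDual.isCompact_closedBall (𝕜 := ℂ) (E := Lp ℂ 2 (volume : Measure E)) 0 (C : ℝ)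
  obtain ⟨l, -, hl⟩ := hcomp.exists_mapClusterPt (f := 𝓝[≠] (0 : ℝ)) (u := Q) (by
    refine tendsto_principal.2 ?_
    filter_upwards [self_mem_nhdsWithin] with t ht
    simp only [Set.mem_preimage, Metric.mem_closedBall, dist_zero_right]
    change ‖InnerProductSpace.toDual ℂ _ (q t)‖ ≤ C
    rw [LinearIsometryEquiv.norm_map]
    exact hqn t ht)
  obtain ⟨U, hU, hlim⟩ := mapClusterPt_iff_ultrafilter.1 hl
  set g : Lp ℂ 2 (volume : Measure E) :=
    (InnerProductSpace.toDual ℂ _).symm (WeakDual.toStrongDual l)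
  refine ⟨g, Lp.memLp g, fun φ hφ hc => ?_⟩
  have hφ2 : MemLp (fun x => (φ x : ℂ)) 2 volume :=
    (Complex.continuous_ofReal.comp hφ.continuous).memLp_of_hasCompactSupport
      (hc.comp_left (g := fun r : ℝ => (r : ℂ)) (by simp))
  have hinner : ∀ w : Lp ℂ 2 (volume : Measure E),
      inner ℂ hφ2.toLp w = ∫ x, φ x • w x := by
    intro w
    rw [L2.inner_def]
    refine integral_congr_ae ?_
    filter_upwards [hφ2.coeFn_toLp] with x hx
    rw [hx]; simp [mul_comm]
  have h1 : Tendsto (fun t => inner ℂ (q t) hφ2.toLp) U (𝓝 (inner ℂ g hφ2.toLp)) := by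
    have h2 := (WeakDual.eval_continuous hφ2.toLp).continuousAt.tendsto.comp hlim
    have h3 : inner ℂ g hφ2.toLp = l hφ2.toLp := by
      rw [InnerProductSpace.toDual_symm_apply]; rfl
    rw [h3]
    exact h2
  have h2 : Tendsto (fun t => inner ℂ hφ2.toLp (q t)) U (𝓝 (inner ℂ hφ2.toLp g)) := by
    have := (Complex.continuous_conj.tendsto _).comp h1
    simpa [Function.comp_def, inner_conj_symm] using this
  -- Against a test function the quotients converge along the whole punctured neighbourhood, since
  -- the difference can be moved onto `φ`. Uniqueness of limits along the ultrafilter identifies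
  -- `g`.
  have h3 : Tendsto (fun t => inner ℂ hφ2.toLp (q t)) (𝓝[≠] 0)
      (𝓝 (- ∫ x, (fderiv ℝ φ x v) • u x)) := by
    have hd := (hasDerivAt_integral_translate_smul hφ hc hu v).tendsto_slope
    refine hd.congr' ?_
    filter_upwards [self_mem_nhdsWithin] with t ht
    rw [hinner, slope_def_module]
    have e1 : ∫ x, φ x • (q t) x = ∫ x, (t : ℂ)⁻¹ • (φ x • u (x + t • v) - φ x • u x) := by
      refine integral_congr_ae ?_
      filter_upwards [(hq t).coeFn_toLp] with x hx
      rw [hx]; simp; ring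
    have hi : ∀ w : E → ℂ, MemLp w 2 volume → Integrable (fun x => φ x • w x) := fun w hw =>
      (hw.locallyIntegrable (by norm_num)).integrable_smul_left_of_hasCompactSupport
        hφ.continuous hc
    rw [e1, integral_smul, integral_sub (hi _ (hu.comp_translate _)) (hi _ hu)]
    have e2 : ∫ x, φ (x - t • v) • u x = ∫ x, φ x • u (x + t • v) := by
      rw [← integral_add_right_eq_self _ (t • v)]
      simp
    rw [e2]
    simp
  have h4 := tendsto_nhds_unique h2 (h3.mono_left hU)
  rw [hinner] at h4
  rw [h4, neg_neg]

end Equivalence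

/-! ### Stability of Lipschitz translates under algebraic operations -/

section Calculus

variable {E F : Type*} [NormedAddCommGroup E] [NormedSpace ℝ E] [MeasureSpace E] [BorelSpace E]
  [(volume : Measure E).IsAddHaarMeasure] [NormedAddCommGroup F]

theorem MeasureTheory.AEStronglyMeasurable.comp_translate {u : E → F}
    (hu : AEStronglyMeasurable u volume) (a : E) :
    AEStronglyMeasurable (fun x => u (x + a)) volume :=
  hu.comp_measurePreserving (measurePreserving_add_right volume a)

theorem eLpNorm_comp_translate {u : E → F} (hu : AEStronglyMeasurable u volume) (a : E) :
    eLpNorm (fun x => u (x + a)) 2 volume = eLpNorm u 2 volume :=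
  eLpNorm_comp_measurePreserving hu (measurePreserving_add_right volume a)

theorem lipTranslates_zero_dir (u : E → F) : LipTranslates 0 u :=
  ⟨0, fun t => by simp⟩

theorem LipTranslates.add_dir {u : E → F} (hu : AEStronglyMeasurable u volume) {v v' : E}
    (h : LipTranslates v u) (h' : LipTranslates v' u) : LipTranslates (v + v') u := by
  obtain ⟨C, hC⟩ := h
  obtain ⟨C', hC'⟩ := h'
  refine ⟨C + C', fun t => ?_⟩
  have hm : AEStronglyMeasurable (fun x => u (x + t • v) - u x) volume :=
    (hu.comp_translate _).sub hu
  have hm' : AEStronglyMeasurable (fun x => u (x + t • v') - u x) volume :=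
    (hu.comp_translate _).sub hu
  have e : (fun x => u (x + t • (v + v')) - u x)
      = (fun x => u (x + t • v' + t • v) - u (x + t • v')) + fun x => u (x + t • v') - u x := by
    ext x
    simp only [Pi.add_apply, sub_add_sub_cancel]
    rw [smul_add, add_assoc, add_comm (t • v) (t • v')]
  rw [e]
  refine (eLpNorm_add_le (hm.comp_translate (t • v')) hm' (by norm_num)).trans ?_
  rw [eLpNorm_comp_translate (u := fun x => u (x + t • v) - u x) hm]
  push_cast
  rw [add_mul]
  exact add_le_add (hC t) (hC' t)

theorem LipTranslates.sum_dir {ι : Type*} {u : E → F} (hu : AEStronglyMeasurable u volume)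
    {v : ι → E} (s : Finset ι) (h : ∀ i ∈ s, LipTranslates (v i) u) :
    LipTranslates (∑ i ∈ s, v i) u :=
  Finset.sum_induction v (fun w => LipTranslates w u) (fun _ _ ha hb => ha.add_dir hu hb)
    (lipTranslates_zero_dir u) h

theorem lipTranslates_zero (v : E) : LipTranslates v (0 : E → F) :=
  ⟨0, fun t => by simp⟩

theorem LipTranslates.add {u w : E → F} (hu : AEStronglyMeasurable u volume)
    (hw : AEStronglyMeasurable w volume) {v : E} (h : LipTranslates v u)
    (h' : LipTranslates v w) : LipTranslates v (u + w) := by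
  obtain ⟨C, hC⟩ := h
  obtain ⟨C', hC'⟩ := h'
  refine ⟨C + C', fun t => ?_⟩
  have e : (fun x => (u + w) (x + t • v) - (u + w) x)
      = (fun x => u (x + t • v) - u x) + fun x => w (x + t • v) - w x := by
    ext x; simp only [Pi.add_apply]; abel
  rw [e]
  refine (eLpNorm_add_le ((hu.comp_translate _).sub hu) ((hw.comp_translate _).sub hw)
    (by norm_num)).trans ?_
  push_cast
  rw [add_mul]
  exact add_le_add (hC t) (hC' t)

theorem LipTranslates.sum {ι : Type*} {u : ι → E → F} (s : Finset ι)
    (hu : ∀ i ∈ s, AEStronglyMeasurable (u i) volume)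
    {v : E} (h : ∀ i ∈ s, LipTranslates v (u i)) : LipTranslates v (∑ i ∈ s, u i) :=
  (Finset.sum_induction u (fun w => AEStronglyMeasurable w volume ∧ LipTranslates v w)
    (fun _ _ ha hb => ⟨ha.1.add hb.1, ha.2.add ha.1 hb.1 hb.2⟩)
    ⟨aestronglyMeasurable_zero, lipTranslates_zero v⟩ fun i hi => ⟨hu i hi, h i hi⟩).2

theorem LipTranslates.of_norm_le {G : Type*} [NormedAddCommGroup G] {u : E → F} {w : E → G}
    {v : E} (h : LipTranslates v u) (c : NNReal)
    (hw : ∀ x y, ‖w x - w y‖ ≤ c * ‖u x - u y‖) : LipTranslates v w := by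
  obtain ⟨C, hC⟩ := h
  refine ⟨c * C, fun t => ?_⟩
  refine (eLpNorm_le_nnreal_smul_eLpNorm_of_ae_le_mul (c := c)
    (g := fun x => u (x + t • v) - u x) (Eventually.of_forall fun x => ?_) 2).trans ?_
  · exact hw _ _
  · push_cast
    rw [mul_assoc]
    exact mul_le_mul_right (hC t) _

theorem LipTranslates.const_smul {𝕜 : Type*} [NormedField 𝕜] [NormedSpace 𝕜 F] {u : E → F}
    {v : E} (h : LipTranslates v u) (a : 𝕜) : LipTranslates v (a • u) :=
  h.of_norm_le ‖a‖₊ fun x y => by simp [← smul_sub, norm_smul]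

/-- Multiplication by a bounded Lipschitz function. -/
theorem LipTranslates.lipschitz_mul {u : E → ℝ} (hu : MemLp u 2 volume) {v : E}
    (h : LipTranslates v u) {f : E → ℝ} {L : NNReal} (hf : LipschitzWith L f) {B : NNReal}
    (hB : ∀ x, |f x| ≤ B) : LipTranslates v (fun x => f x * u x) := by
  obtain ⟨C, hC⟩ := h
  refine ⟨B * C + L * ‖v‖₊ * (eLpNorm u 2 volume).toNNReal, fun t => ?_⟩
  have e : (fun x => f (x + t • v) * u (x + t • v) - f x * u x)
      = (fun x => f (x + t • v) * (u (x + t • v) - u x))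
        + fun x => (f (x + t • v) - f x) * u x := by
    ext x; simp only [Pi.add_apply]; ring
  have hfc := hf.continuous.measurable.aestronglyMeasurable (μ := (volume : Measure E))
  have hum := hu.aestronglyMeasurable
  rw [e]
  refine (eLpNorm_add_le ((hfc.comp_translate _).mul ((hum.comp_translate _).sub hum))
    (((hfc.comp_translate _).sub hfc).mul hum) (by norm_num)).trans ?_
  push_cast
  rw [add_mul, ENNReal.coe_toNNReal hu.eLpNorm_ne_top]
  refine add_le_add ?_ ?_
  · refine (eLpNorm_le_nnreal_smul_eLpNorm_of_ae_le_mul (c := B)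
      (g := fun x => u (x + t • v) - u x) (Eventually.of_forall fun x => ?_) 2).trans ?_
    · rw [← NNReal.coe_le_coe]
      simp only [Pi.mul_apply, Pi.sub_apply, nnnorm_mul, NNReal.coe_mul, coe_nnnorm]
      exact mul_le_mul_of_nonneg_right (hB _) (norm_nonneg _)
    · rw [mul_assoc]
      exact mul_le_mul_right (hC t) _
  · refine (eLpNorm_le_nnreal_smul_eLpNorm_of_ae_le_mul (c := L * (‖t‖₊ * ‖v‖₊))
      (g := u) (Eventually.of_forall fun x => ?_) 2).trans_eq ?_
    · rw [← NNReal.coe_le_coe]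
      simp only [Pi.mul_apply, Pi.sub_apply, nnnorm_mul, NNReal.coe_mul, coe_nnnorm]
      refine mul_le_mul_of_nonneg_right ?_ (norm_nonneg _)
      have := hf.dist_le_mul (x + t • v) x
      rw [dist_eq_norm, dist_eq_norm, add_sub_cancel_left, norm_smul] at this
      exact_mod_cast this
    · rw [ENNReal.smul_def, smul_eq_mul]
      push_cast
      rw [enorm_eq_nnnorm]
      ring

theorem MeasureTheory.MemLp.bounded_mul {α : Type*} [MeasurableSpace α] {μ : Measure α}
    {u : α → ℝ} (hu : MemLp u 2 μ) {f : α → ℝ} (hf : Measurable f) {B : ℝ}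
    (hB : ∀ x, |f x| ≤ B) : MemLp (fun x => f x * u x) 2 μ :=
  hu.of_le_mul (c := B) (hf.aestronglyMeasurable.mul hu.aestronglyMeasurable)
    (Eventually.of_forall fun x => by
      rw [norm_mul]; exact mul_le_mul_of_nonneg_right (hB x) (norm_nonneg _))

end Calculus

/-! ### Fubini and tensor products on configuration space -/

section Config

/-- Fubini for the first particle. -/
theorem lintegral_config_succ {n : ℕ} {F : Config (n + 1) → ℝ≥0∞} (hF : AEMeasurable F) :
    ∫⁻ x, F x = ∫⁻ x₁ : R3, ∫⁻ y : Config n, F (Fin.cons x₁ y) := by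
  have hp := (volume_preserving_piFinSuccAbove (fun _ : Fin (n + 1) => R3) 0).symm
  rw [← hp.lintegral_comp_emb (MeasurableEquiv.measurableEmbedding _), Measure.volume_eq_prod,
    lintegral_prod]
  · simp only [MeasurableEquiv.piFinSuccAbove_symm_apply, Fin.insertNthEquiv_zero]
    rfl
  · exact hF.comp_quasiMeasurePreserving hp.quasiMeasurePreserving

theorem measurable_config_prod {N : ℕ} {M : Type*} [CommMonoid M] [MeasurableSpace M]
    [MeasurableMul₂ M] {f : Fin N → R3 → M} (hf : ∀ i, Measurable (f i)) :
    Measurable fun x : Config N => ∏ i, f i (x i) :=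
  Finset.measurable_fun_prod _ fun i _ => (hf i).comp (measurable_pi_apply i)

theorem lintegral_config_prod {N : ℕ} {f : Fin N → R3 → ℝ≥0∞} (hf : ∀ i, Measurable (f i)) :
    ∫⁻ x : Config N, ∏ i, f i (x i) = ∏ i, ∫⁻ y, f i y := by
  induction N with
  | zero =>
    simp only [Finset.univ_eq_empty, Finset.prod_empty, lintegral_const, one_mul]
    rw [volume_pi, Measure.pi_of_empty _ default]
    simp
  | succ n ih =>
    rw [lintegral_config_succ (measurable_config_prod hf).aemeasurable]
    simp only [Fin.prod_univ_succ, Fin.cons_zero, Fin.cons_succ]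
    have : ∀ x₁ : R3, ∫⁻ y : Config n, f 0 x₁ * ∏ i : Fin n, f i.succ (y i)
        = f 0 x₁ * ∏ i : Fin n, ∫⁻ y, f i.succ y := fun x₁ => by
      rw [lintegral_const_mul _ (measurable_config_prod fun i => hf i.succ), ih fun i => hf _]
    simp_rw [this]
    rw [lintegral_mul_const _ (hf 0)]

theorem eLpNorm_two_eq {α F : Type*} [MeasurableSpace α] [NormedAddCommGroup F] {μ : Measure α}
    (f : α → F) : eLpNorm f 2 μ = (∫⁻ x, ‖f x‖ₑ ^ 2 ∂μ) ^ (1 / 2 : ℝ) := by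
  rw [eLpNorm_eq_lintegral_rpow_enorm_toReal (by norm_num) (by norm_num)]
  simp

theorem eLpNorm_config_prod {N : ℕ} {f : Fin N → R3 → ℝ} (hf : ∀ i, Measurable (f i)) :
    eLpNorm (fun x : Config N => ∏ i, f i (x i)) 2 volume = ∏ i, eLpNorm (f i) 2 volume := by
  simp_rw [eLpNorm_two_eq]
  rw [ENNReal.prod_rpow_of_nonneg (by norm_num), ← lintegral_config_prod fun i => by fun_prop]
  congr 2; ext x
  rw [Finset.prod_pow, enorm_eq_nnnorm, nnnorm_prod]
  push_cast
  rfl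

theorem memLp_config_prod {N : ℕ} {f : Fin N → R3 → ℝ} (hf : ∀ i, Measurable (f i))
    (h2 : ∀ i, MemLp (f i) 2 volume) :
    MemLp (fun x : Config N => ∏ i, f i (x i)) 2 volume := by
  refine ⟨(measurable_config_prod hf).aestronglyMeasurable, ?_⟩
  rw [eLpNorm_config_prod hf]
  exact ENNReal.prod_lt_top fun i _ => (h2 i).2

/-- A translation of a single particle changes a single factor, and the `L²` norm of a tensor
product factorizes. A general direction is a sum of single-particle ones. -/
theorem lipTranslates_config_prod {N : ℕ} {f : Fin N → R3 → ℝ} (hf : ∀ i, Measurable (f i))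
    (h2 : ∀ i, MemLp (f i) 2 volume) (hT : ∀ i v, LipTranslates v (f i)) (v : Config N) :
    LipTranslates v (fun x : Config N => ∏ i, f i (x i)) := by
  classical
  have hv : v = ∑ i, Pi.single i (v i) := (Finset.univ_sum_single v).symm
  rw [hv]
  refine LipTranslates.sum_dir (memLp_config_prod hf h2).aestronglyMeasurable _ fun i _ => ?_
  obtain ⟨C, hC⟩ := hT i (v i)
  refine ⟨(∏ j ∈ Finset.univ.erase i, (eLpNorm (f j) 2 volume).toNNReal) * C, fun t => ?_⟩
  set g : Fin N → R3 → ℝ := Function.update f i fun y => f i (y + t • v i) - f i y with hg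
  have hgm : ∀ j, Measurable (g j) := by
    intro j
    by_cases hj : j = i
    · subst hj
      simp only [hg, Function.update_self]
      exact ((hf j).comp (measurable_add_const _)).sub (hf j)
    · simp only [hg, Function.update_of_ne hj]
      exact hf j
  have e : (fun x : Config N => ∏ j, f j ((x + t • (Pi.single i (v i) : Config N)) j)
      - ∏ j, f j (x j)) = fun x : Config N => ∏ j, g j (x j) := by
    ext x
    rw [← Finset.mul_prod_erase _ _ (Finset.mem_univ i),
      ← Finset.mul_prod_erase _ (fun j => f j (x j)) (Finset.mem_univ i),
      ← Finset.mul_prod_erase _ (fun j => g j (x j)) (Finset.mem_univ i)]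
    have h1 : ∏ j ∈ Finset.univ.erase i, f j ((x + t • (Pi.single i (v i) : Config N)) j)
        = ∏ j ∈ Finset.univ.erase i, f j (x j) := by
      refine Finset.prod_congr rfl fun j hj => ?_
      simp [Pi.single_eq_of_ne (Finset.ne_of_mem_erase hj)]
    have h3 : ∏ j ∈ Finset.univ.erase i, g j (x j)
        = ∏ j ∈ Finset.univ.erase i, f j (x j) := by
      refine Finset.prod_congr rfl fun j hj => ?_
      simp [hg, Function.update_of_ne (Finset.ne_of_mem_erase hj)]
    rw [h1, h3]
    simp [hg, sub_mul]
  rw [e, eLpNorm_config_prod hgm, ← Finset.mul_prod_erase _ _ (Finset.mem_univ i)]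
  have h3 : ∏ j ∈ Finset.univ.erase i, eLpNorm (g j) 2 volume
      = ∏ j ∈ Finset.univ.erase i, eLpNorm (f j) 2 volume := by
    refine Finset.prod_congr rfl fun j hj => ?_
    simp [hg, Function.update_of_ne (Finset.ne_of_mem_erase hj)]
  rw [h3]
  push_cast
  simp_rw [ENNReal.coe_toNNReal (h2 _).eLpNorm_ne_top]
  rw [mul_comm, mul_assoc]
  refine mul_le_mul_right ?_ _
  simp only [hg, Function.update_self]
  exact hC t

end Config

/-! ### Antisymmetric superpositions of orbitals with disjoint supports -/

section Slot

variable {N M : ℕ}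

/-- An antisymmetric choice of signs on the labellings of `N` particles. -/
def orderSign (k : Fin N → Fin M) : ℝ :=
  (SignType.sign (Matrix.vandermonde fun i => ((k i : ℕ) : ℝ)).det : ℝ)

/-- Permuting the labels permutes the rows of the Vandermonde matrix, so its determinant picks up
the sign of the permutation. -/
theorem orderSign_comp_perm (k : Fin N → Fin M) (σ : Equiv.Perm (Fin N)) :
    orderSign (fun i => k (σ i)) = ((Equiv.Perm.sign σ : ℤ) : ℝ) * orderSign k := by
  have h : (Matrix.vandermonde fun i => ((k (σ i) : ℕ) : ℝ))
      = (Matrix.vandermonde fun i => ((k i : ℕ) : ℝ)).submatrix σ id := by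
    ext i j; simp [Matrix.vandermonde_apply]
  unfold orderSign
  rw [h, Matrix.det_permute, sign_mul]
  rcases Int.units_eq_one_or (Equiv.Perm.sign σ) with h | h <;> simp [h]

theorem orderSign_sq {k : Fin N → Fin M} (hk : Function.Injective k) : orderSign k ^ 2 = 1 := by
  have h : (Matrix.vandermonde fun i => ((k i : ℕ) : ℝ)).det ≠ 0 :=
    Matrix.det_vandermonde_ne_zero_iff.2 fun i j hij => hk (Fin.ext (by exact_mod_cast hij))
  unfold orderSign
  rcases lt_or_gt_of_ne h with h | h
  · simp [sign_neg h]
  · simp [sign_pos h]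

/-- Superposition of Slater-type products of the orbitals `φ`, with `w` the probability weights of
the labellings. -/
def slot (φ : Fin M → R3 → ℝ) (w : (Fin N → Fin M) → ℝ) (x : Config N) : ℝ :=
  ∑ k, orderSign k * √(w k) * ∏ i, φ (k i) (x i)

/-- Compatibility of orbitals and weights. -/
structure IsSlot (φ : Fin M → R3 → ℝ) (w : (Fin N → Fin M) → ℝ) : Prop where
  measurable : ∀ j, Measurable (φ j)
  memLp : ∀ j, MemLp (φ j) 2 volume
  lip : ∀ j v, LipTranslates v (φ j)
  disjoint : ∀ i j, i ≠ j → ∀ x, φ i x * φ j x = 0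
  nonneg : ∀ k, 0 ≤ w k
  symm : ∀ (σ : Equiv.Perm (Fin N)) k, w (fun i => k (σ i)) = w k
  inj : ∀ k, w k ≠ 0 → Function.Injective k

variable {φ : Fin M → R3 → ℝ} {w : (Fin N → Fin M) → ℝ}

namespace IsSlot

theorem measurable_slot (h : IsSlot φ w) : Measurable (slot φ w) :=
  Finset.measurable_fun_sum _ fun k _ =>
    (measurable_config_prod fun i => h.measurable (k i)).const_mul _

theorem slot_eq (φ : Fin M → R3 → ℝ) (w : (Fin N → Fin M) → ℝ) : slot φ w
    = ∑ k, (orderSign k * √(w k)) • fun x : Config N => ∏ i, φ (k i) (x i) := by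
  ext x; simp [slot]

theorem memLp_slot (h : IsSlot φ w) : MemLp (slot φ w) 2 volume := by
  rw [slot_eq]
  exact memLp_finsetSum' _ fun k _ =>
    (memLp_config_prod (fun i => h.measurable _) fun i => h.memLp _).const_smul _

theorem lipTranslates_slot (h : IsSlot φ w) (v : Config N) : LipTranslates v (slot φ w) := by
  rw [slot_eq]
  refine LipTranslates.sum _ (fun k _ => ?_) fun k _ => ?_
  · exact ((memLp_config_prod (fun i => h.measurable _) fun i => h.memLp _).const_smul
      _).aestronglyMeasurable
  · exact (lipTranslates_config_prod (fun i => h.measurable _) (fun i => h.memLp _)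
      (fun i => h.lip _) v).const_smul _

theorem slot_comp_perm (h : IsSlot φ w) (σ : Equiv.Perm (Fin N)) (x : Config N) :
    slot φ w (fun i => x (σ i)) = ((Equiv.Perm.sign σ : ℤ) : ℝ) * slot φ w x := by
  unfold slot
  rw [← (Equiv.arrowCongr σ (Equiv.refl (Fin M))).symm.sum_comp, Finset.mul_sum]
  refine Finset.sum_congr rfl fun k _ => ?_
  have e : (Equiv.arrowCongr σ (Equiv.refl (Fin M))).symm k = fun i => k (σ i) := by
    ext i; simp [Equiv.arrowCongr]
  rw [e, orderSign_comp_perm, h.symm, Equiv.prod_comp σ fun i => φ (k i) (x i)]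
  ring

/-- Two different labellings differ at some particle, where the two orbitals have disjoint supports,
so every cross term vanishes. On the diagonal the sign squares to one, since labellings with
repetitions carry no weight. -/
theorem slot_sq (h : IsSlot φ w) (x : Config N) :
    slot φ w x ^ 2 = ∑ k, w k * ∏ i, φ (k i) (x i) ^ 2 := by
  unfold slot
  rw [sq, Finset.sum_mul_sum]
  refine Finset.sum_congr rfl fun k _ => ?_
  rw [Finset.sum_eq_single k]
  · rw [Finset.prod_pow]
    by_cases hk : w k = 0
    · simp [hk]
    · have h1 := orderSign_sq (h.inj k hk)
      have h2 := Real.sq_sqrt (h.nonneg k)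
      calc _ = orderSign k ^ 2 * √(w k) ^ 2 * (∏ i, φ (k i) (x i)) ^ 2 := by ring
        _ = _ := by rw [h1, h2, one_mul]
  · intro l _ hl
    obtain ⟨i, hi⟩ := Function.ne_iff.1 hl.symm
    have : (∏ i, φ (k i) (x i)) * ∏ i, φ (l i) (x i) = 0 := by
      rw [← Finset.prod_mul_distrib]
      exact Finset.prod_eq_zero (Finset.mem_univ i) (h.disjoint _ _ hi _)
    linear_combination (orderSign k * √(w k) * (orderSign l * √(w l))) * this
  · simp

theorem ofReal_slot_sq (h : IsSlot φ w) (x : Config N) :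
    ENNReal.ofReal (slot φ w x ^ 2)
      = ∑ k, ENNReal.ofReal (w k) * ∏ i, ENNReal.ofReal (φ (k i) (x i) ^ 2) := by
  rw [h.slot_sq, ENNReal.ofReal_sum_of_nonneg fun k _ =>
    mul_nonneg (h.nonneg k) (Finset.prod_nonneg fun _ _ => sq_nonneg _)]
  refine Finset.sum_congr rfl fun k _ => ?_
  rw [ENNReal.ofReal_mul (h.nonneg k), ENNReal.ofReal_prod_of_nonneg fun _ _ => sq_nonneg _]

theorem measurable_ofReal_sq (h : IsSlot φ w) (j : Fin M) :
    Measurable fun y => ENNReal.ofReal (φ j y ^ 2) :=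
  ((h.measurable j).pow_const 2).ennreal_ofReal

/-- The orbitals in use are normalized. -/
def Normalized (φ : Fin M → R3 → ℝ) (w : (Fin N → Fin M) → ℝ) : Prop :=
  ∀ k, w k ≠ 0 → ∀ i, ∫⁻ y, ENNReal.ofReal (φ (k i) y ^ 2) = 1

theorem lintegral_slot_sq (h : IsSlot φ w) (hn : Normalized φ w) :
    ∫⁻ x, ENNReal.ofReal (slot φ w x ^ 2) = ∑ k, ENNReal.ofReal (w k) := by
  simp_rw [h.ofReal_slot_sq]
  rw [lintegral_finsetSum _ fun k _ =>
    (measurable_config_prod fun i => h.measurable_ofReal_sq (k i)).const_mul _]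
  refine Finset.sum_congr rfl fun k _ => ?_
  rw [lintegral_const_mul _ (measurable_config_prod fun i => h.measurable_ofReal_sq (k i)),
    lintegral_config_prod fun i => h.measurable_ofReal_sq (k i)]
  by_cases hk : w k = 0
  · simp [hk]
  · rw [Finset.prod_eq_one fun i _ => hn k hk i, mul_one]

end IsSlot

/-- Without cross terms, integrating out the other particles only produces norms of orbitals in use,
which are one. -/
theorem IsSlot.lintegral_slot_cons_sq {n : ℕ} {w : (Fin (n + 1) → Fin M) → ℝ} (h : IsSlot φ w)
    (hn : IsSlot.Normalized φ w) (x₁ : R3) :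
    ∫⁻ y : Config n, ENNReal.ofReal (slot φ w (Fin.cons x₁ y) ^ 2)
      = ∑ k, ENNReal.ofReal (w k * φ (k 0) x₁ ^ 2) := by
  simp_rw [h.ofReal_slot_sq, Fin.prod_univ_succ, Fin.cons_zero, Fin.cons_succ]
  have hm : ∀ k : Fin (n + 1) → Fin M, Measurable fun y : Config n =>
      ∏ i : Fin n, ENNReal.ofReal (φ (k i.succ) (y i) ^ 2) := fun k =>
    measurable_config_prod fun i => h.measurable_ofReal_sq (k i.succ)
  rw [lintegral_finsetSum _ fun k _ => ((hm k).const_mul _).const_mul _]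
  refine Finset.sum_congr rfl fun k _ => ?_
  rw [lintegral_const_mul _ ((hm k).const_mul _), lintegral_const_mul _ (hm k),
    lintegral_config_prod fun i => h.measurable_ofReal_sq (k i.succ)]
  by_cases hk : w k = 0
  · simp [hk]
  · rw [Finset.prod_eq_one fun i _ => hn k hk i.succ, mul_one, ENNReal.ofReal_mul (h.nonneg k)]

end Slot

/-! ### Wavefunctions with two populated spin configurations -/

section Spin

variable {n : ℕ} {f : Fin 3 → Config (n + 1) → ℝ}

/-- The wavefunction `f₀ ↑⋯↑ + (f₁ + i f₂) ↓⋯↓`. -/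
def spinWave (f : Fin 3 → Config (n + 1) → ℝ) : Wavefunction (n + 1) := fun s x =>
  if s = 0 then (f 0 x : ℂ) else if s = 1 then (f 1 x : ℂ) + Complex.I * (f 2 x : ℂ) else 0

/-- The densities add without interference: different spin configurations never mix, and `f 1`, `f
2` are real and imaginary parts of the same component. -/
theorem positionDensity_spinWave (x : Config (n + 1)) :
    positionDensity (spinWave f) x = ∑ a, ENNReal.ofReal (f a x ^ 2) := by
  have h01 : (0 : Spins (n + 1)) ≠ 1 := fun h => by
    have := congrFun h 0
    simp at this
  unfold positionDensity
  rw [Finset.sum_eq_add (0 : Spins (n + 1)) 1 h01 (fun s _ hs => by simp [spinWave, hs.1, hs.2])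
    (by simp) (by simp)]
  have h1 : ∀ z : ℂ, ‖z‖ₑ ^ 2 = ENNReal.ofReal (z.re ^ 2 + z.im ^ 2) := fun z => by
    rw [← ofReal_norm, ← ENNReal.ofReal_pow (norm_nonneg _), Complex.sq_norm,
      Complex.normSq_apply, sq, sq]
  rw [h1, h1, Fin.sum_univ_three, add_assoc, ← ENNReal.ofReal_add (sq_nonneg (f 1 x)) (sq_nonneg _)]
  simp [spinWave, h01.symm]

/-- Both populated spin configurations are constant, hence fixed by every permutation, so
antisymmetry reduces to that of the spatial functions. -/
theorem admissible_spinWave (h2 : ∀ a, MemLp (f a) 2 volume)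
    (hl : ∀ a v, LipTranslates v (f a))
    (hs : ∀ a (σ : Equiv.Perm (Fin (n + 1))) x,
      f a (fun i => x (σ i)) = ((Equiv.Perm.sign σ : ℤ) : ℝ) * f a x)
    (h1 : ∫⁻ x, ∑ a, ENNReal.ofReal (f a x ^ 2) = 1) : Admissible (spinWave f) := by
  have hc2 : ∀ a, MemLp (fun x => (f a x : ℂ)) 2 volume := fun a => (h2 a).ofReal
  have hcl : ∀ a v, LipTranslates v (fun x => (f a x : ℂ)) := fun a v =>
    (hl a v).of_norm_le 1 fun x y => by
      rw [← Complex.ofReal_sub, Complex.norm_real]; simp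
  have key : ∀ s, MemLp (spinWave f s) 2 volume ∧ ∀ v, LipTranslates v (spinWave f s) := by
    intro s
    by_cases h0 : s = 0
    · have : spinWave f s = fun x => (f 0 x : ℂ) := by ext x; simp [spinWave, h0]
      rw [this]
      exact ⟨hc2 0, hcl 0⟩
    by_cases h1 : s = 1
    · have : spinWave f s = (fun x => (f 1 x : ℂ)) + Complex.I • fun x => (f 2 x : ℂ) := by
        ext x; simp only [spinWave, if_neg h0, if_pos h1]; rfl
      rw [this]
      have h3 := (hc2 2).const_smul Complex.I
      exact ⟨(hc2 1).add h3, fun v => (hcl 1 v).add (hc2 1).aestronglyMeasurable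
        h3.aestronglyMeasurable ((hcl 2 v).const_smul _)⟩
    · have : spinWave f s = 0 := by ext x; simp [spinWave, h0, h1]
      rw [this]
      exact ⟨MemLp.zero, lipTranslates_zero⟩
  refine ⟨fun s => ⟨(key s).1, fun v => ((key s).2 v).exists_hasWeakDeriv (key s).1⟩, ?_, ?_⟩
  · intro σ s
    refine Eventually.of_forall fun x => ?_
    have e0 : (fun i => s (σ i)) = 0 ↔ s = 0 := by
      constructor
      · intro h; ext i; simpa using congrFun h (σ.symm i)
      · rintro rfl; rfl
    have e1 : (fun i => s (σ i)) = 1 ↔ s = 1 := by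
      constructor
      · intro h; ext i; simpa using congrFun h (σ.symm i)
      · rintro rfl; rfl
    simp only [spinWave, e0, e1, hs]
    split_ifs
    · push_cast; rfl
    · push_cast; ring
    · simp
  · simp_rw [positionDensity_spinWave]
    exact h1

end Spin

/-! ### The lower bound and the reduction to nearly optimal wavefunctions -/

theorem measurable_coulomb {N : ℕ} : Measurable (coulomb : Config N → ℝ≥0∞) := by
  unfold coulomb
  fun_prop

theorem memLp_weakDeriv {X F : Type*} [NormedAddCommGroup X] [NormedSpace ℝ X] [MeasureSpace X]
    [NormedAddCommGroup F] [NormedSpace ℝ F] {u : X → F} (hu : MemH1 u) (v : X) :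
    MemLp (weakDeriv v u) 2 volume := by
  unfold weakDeriv
  rw [dif_pos (hu.2 v)]
  exact (hu.2 v).choose_spec.1

theorem MeasureTheory.MemLp.lintegral_enorm_sq_lt_top {α F : Type*} [MeasurableSpace α]
    [NormedAddCommGroup F] {μ : Measure α} {f : α → F} (hf : MemLp f 2 μ) :
    ∫⁻ x, ‖f x‖ₑ ^ 2 ∂μ < ⊤ := by
  have := hf.2
  rw [eLpNorm_two_eq] at this
  by_contra h
  simp [not_lt_top_iff.1 h] at this

theorem Admissible.kinetic_ne_top {N : ℕ} {Ψ : Wavefunction N} (h : Admissible Ψ) :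
    kinetic Ψ ≠ ⊤ := by
  have hm : ∀ s i k, MemLp (weakDeriv (Pi.single i (EuclideanSpace.single k (1 : ℝ)) : Config N)
      (Ψ s)) 2 volume := fun s i k => memLp_weakDeriv (h.memH1 s) _
  have ha : ∀ s i k, AEMeasurable (fun x => ‖weakDeriv
      (Pi.single i (EuclideanSpace.single k (1 : ℝ)) : Config N) (Ψ s) x‖ₑ ^ 2) volume :=
    fun s i k => (hm s i k).aestronglyMeasurable.enorm.pow_const 2
  unfold kinetic
  rw [lintegral_finsetSum' _ fun s _ => Finset.aemeasurable_fun_sum _ fun i _ =>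
    Finset.aemeasurable_fun_sum _ fun k _ => ha s i k]
  refine ENNReal.sum_ne_top.2 fun s _ => ?_
  rw [lintegral_finsetSum' _ fun i _ => Finset.aemeasurable_fun_sum _ fun k _ => ha s i k]
  refine ENNReal.sum_ne_top.2 fun i _ => ?_
  rw [lintegral_finsetSum' _ fun k _ => ha s i k]
  exact ENNReal.sum_ne_top.2 fun k _ => (hm s i k).lintegral_enorm_sq_lt_top.ne

theorem Admissible.aemeasurable_positionDensity {N : ℕ} {Ψ : Wavefunction N}
    (h : Admissible Ψ) : AEMeasurable (positionDensity Ψ) :=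
  Finset.aemeasurable_fun_sum _ fun s _ => (h.memH1 s).1.aestronglyMeasurable.enorm.pow_const 2

theorem measurePreserving_comp_perm {N : ℕ} (σ : Equiv.Perm (Fin N)) :
    MeasurePreserving (fun (x : Config N) i => x (σ i)) volume volume := by
  have h := (volume_measurePreserving_piCongrLeft (fun _ : Fin N => R3) σ).symm
  exact h

theorem positionDensity_comp_perm {N : ℕ} {Ψ : Wavefunction N} (h : Antisymmetric Ψ)
    (σ : Equiv.Perm (Fin N)) :
    ∀ᵐ x, positionDensity Ψ (fun i => x (σ i)) = positionDensity Ψ x := by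
  filter_upwards [ae_all_iff.2 fun s => h σ s] with x hx
  unfold positionDensity
  rw [← (Equiv.arrowCongr σ (Equiv.refl (ZMod 2))).symm.sum_comp]
  refine Finset.sum_congr rfl fun s _ => ?_
  have e : (Equiv.arrowCongr σ (Equiv.refl (ZMod 2))).symm s = fun i => s (σ i) := by
    ext i; simp [Equiv.arrowCongr]
  rw [e, hx s]
  rcases Int.units_eq_one_or (Equiv.Perm.sign σ) with h | h <;> simp [h]

/-- The position density of `Ψ` is itself the density of a competitor in the transport problem:
antisymmetry of `Ψ` makes it symmetric. -/
theorem sceFunctional_le_interaction {n : ℕ} {ρ : R3 → ℝ} {Ψ : Wavefunction (n + 1)}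
    (h : Admissible Ψ) (hd : HasDensity Ψ ρ) : sceFunctional n ρ ≤ interaction Ψ := by
  have hm := h.aemeasurable_positionDensity
  set γ : Measure (Config (n + 1)) := volume.withDensity (positionDensity Ψ) with hγ
  have hsym : IsSymmProb γ := by
    refine ⟨⟨?_⟩, fun σ A hA => ?_⟩
    · rw [hγ, withDensity_apply _ .univ, Measure.restrict_univ, h.norm_eq_one]
    · have hA1 : MeasurableSet (Set.univ.pi A) := .univ_pi hA
      have hA2 : MeasurableSet (Set.univ.pi fun i => A (σ i)) := .univ_pi fun i => hA _
      rw [hγ, withDensity_apply _ hA1, withDensity_apply _ hA2, ← lintegral_indicator hA1,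
        ← lintegral_indicator hA2]
      have hp := measurePreserving_comp_perm (σ⁻¹)
      have hemb : MeasurableEmbedding (fun (x : Config (n + 1)) i => x (σ⁻¹ i)) :=
        (MeasurableEquiv.piCongrLeft (fun _ : Fin (n + 1) => R3) σ⁻¹).symm.measurableEmbedding
      rw [← hp.lintegral_comp_emb hemb]
      refine lintegral_congr_ae ?_
      filter_upwards [positionDensity_comp_perm h.antisymm σ⁻¹] with x hx
      have e : (fun i => x (σ⁻¹ i)) ∈ Set.univ.pi A ↔ x ∈ Set.univ.pi fun i => A (σ i) := by
        simp only [Set.mem_univ_pi]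
        constructor
        · intro h i; simpa using h (σ i)
        · intro h i; simpa using h (σ⁻¹ i)
      by_cases hxA : x ∈ Set.univ.pi fun i => A (σ i)
      · rw [Set.indicator_of_mem (e.2 hxA), Set.indicator_of_mem hxA, hx]
      · rw [Set.indicator_of_notMem (mt e.1 hxA), Set.indicator_of_notMem hxA]
  have hmarg : HasMarginal γ ρ := by
    intro A hA
    have hA' : MeasurableSet {x : Config (n + 1) | x 0 ∈ A} := measurable_pi_apply 0 hA
    rw [hγ, withDensity_apply _ hA', ← lintegral_indicator hA', ← lintegral_indicator hA,
      lintegral_config_succ (hm.indicator hA')]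
    refine lintegral_congr_ae ?_
    filter_upwards [hd] with x₁ hx
    by_cases hxA : x₁ ∈ A
    · have : ∀ y : Config n, ({x : Config (n + 1) | x 0 ∈ A}.indicator (positionDensity Ψ))
          (Fin.cons x₁ y) = positionDensity Ψ (Fin.cons x₁ y) := fun y =>
        Set.indicator_of_mem (by simpa using hxA) _
      simp_rw [this]
      rw [Set.indicator_of_mem hxA, ENNReal.ofReal_div_of_pos (by positivity), ← hx,
        ENNReal.ofReal_natCast]
      unfold oneBodyDensity
      rw [mul_comm, ENNReal.mul_div_cancel_right (by simp) (by simp)]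
    · have : ∀ y : Config n, ({x : Config (n + 1) | x 0 ∈ A}.indicator (positionDensity Ψ))
          (Fin.cons x₁ y) = 0 := fun y => Set.indicator_of_notMem (by simpa using hxA) _
      simp_rw [this]
      rw [Set.indicator_of_notMem hxA, lintegral_zero]
  refine (iInf_le _ (⟨γ, hsym, hmarg⟩ :
    {γ : Measure (Config (n + 1)) // IsSymmProb γ ∧ HasMarginal γ ρ})).trans_eq ?_
  simp only [hγ]
  rw [lintegral_withDensity_eq_lintegral_mul₀ hm measurable_coulomb.aemeasurable]
  unfold interaction
  simp_rw [Pi.mul_apply, mul_comm]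

/-- The trial state does not depend on `α`, so its kinetic contribution tends to zero however large
the kinetic energy is. -/
theorem tendsto_hohenbergKohn {n : ℕ} {ρ : R3 → ℝ} (htop : sceFunctional n ρ ≠ ⊤)
    (h : ∀ ε : ℝ≥0∞, ε ≠ 0 → ∃ Ψ : Wavefunction (n + 1), Admissible Ψ ∧ HasDensity Ψ ρ ∧
      interaction Ψ ≤ sceFunctional n ρ + ε) :
    Tendsto (fun α : ℝ => hohenbergKohn n α ρ) (𝓝[>] 0) (𝓝 (sceFunctional n ρ)) := by
  refine (ENNReal.tendsto_nhds htop).2 fun ε hε => ?_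
  obtain ⟨Ψ, hΨ, hd, hV⟩ := h (ε / 2) (ENNReal.half_pos hε.ne').ne'
  have h0 : Tendsto (fun α : ℝ => ENNReal.ofReal α * kinetic Ψ) (𝓝[>] 0) (𝓝 0) := by
    have h1 : Tendsto (fun α : ℝ => ENNReal.ofReal α) (𝓝[>] 0) (𝓝 0) := by
      have := (ENNReal.continuous_ofReal.tendsto 0).mono_left (nhdsWithin_le_nhds (s := Set.Ioi 0))
      simpa using this
    simpa using ENNReal.Tendsto.mul_const h1 (Or.inr hΨ.kinetic_ne_top)
  filter_upwards [h0.eventually (ge_mem_nhds (ENNReal.half_pos hε.ne'))] with α hα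
  constructor
  · refine tsub_le_self.trans (le_iInf fun Φ => ?_)
    exact (sceFunctional_le_interaction Φ.2.1 Φ.2.2).trans le_add_self
  · refine (iInf_le _ (⟨Ψ, hΨ, hd⟩ :
      {Ψ : Wavefunction (n + 1) // Admissible Ψ ∧ HasDensity Ψ ρ})).trans ?_
    calc _ ≤ ε / 2 + (sceFunctional n ρ + ε / 2) := add_le_add hα hV
      _ = sceFunctional n ρ + (ε / 2 + ε / 2) := by ring
      _ = _ := by rw [ENNReal.add_halves]

/-! ### Bounds on the Coulomb potential of a density -/

/-- The part of an `H¹` density in a slab is bounded by the thickness of the slab. -/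
theorem lintegral_slab_le {u : R3 → ℝ} (hu : Measurable u) (hu2 : MemLp u 2 volume) {i : Fin 3}
    {C : NNReal} (hC : ∀ t : ℝ, eLpNorm
      (fun x => u (x + t • EuclideanSpace.single i (1 : ℝ)) - u x) 2 volume ≤ C * ‖t‖ₑ)
    {S : Set R3} (hS : MeasurableSet S)
    (hinv : ∀ (t : ℝ) x, x + t • EuclideanSpace.single i (1 : ℝ) ∈ S ↔ x ∈ S) {a b : ℝ}
    (hab : a ≤ b) :
    ∫⁻ x in S ∩ {x | a ≤ x i ∧ x i < b}, ‖u x‖ₑ ^ 2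
      ≤ 2 * C * ENNReal.ofReal (b - a) * (∫⁻ x in S, ‖u x‖ₑ ^ 2) ^ (1 / 2 : ℝ) := by
  set e : R3 := EuclideanSpace.single i (1 : ℝ) with he
  set t : ℝ := b - a with ht
  have hcoord : Measurable fun x : R3 => x i := by fun_prop
  have hB : MeasurableSet {x : R3 | x i < b} := measurableSet_lt hcoord measurable_const
  have hA : MeasurableSet {x : R3 | x i < a} := measurableSet_lt hcoord measurable_const
  have hshift : Measurable fun x : R3 => u (x + (-t) • e) := hu.comp (measurable_add_const _)
  have hmp : MeasurePreserving (fun x : R3 => x + (-t) • e) volume volume :=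
    measurePreserving_add_right volume _
  have htr : ∀ (T T' : Set R3), MeasurableSet T → MeasurableSet T' →
      (∀ x, x + (-t) • e ∈ T' ↔ x ∈ T) →
      ∫⁻ x in T, ‖u (x + (-t) • e)‖ₑ ^ 2 = ∫⁻ x in T', ‖u x‖ₑ ^ 2 := by
    intro T T' hT hT' h
    rw [← lintegral_indicator hT, ← lintegral_indicator hT',
      ← hmp.lintegral_comp ((hu.enorm.pow_const 2).indicator hT')]
    refine lintegral_congr fun x => ?_
    by_cases hx : x ∈ T
    · rw [Set.indicator_of_mem hx, Set.indicator_of_mem ((h x).2 hx)]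
    · rw [Set.indicator_of_notMem hx, Set.indicator_of_notMem (mt (h x).1 hx)]
  have hfin : ∫⁻ x in S ∩ {x | x i < a}, ‖u x‖ₑ ^ 2 ≠ ⊤ :=
    ((setLIntegral_le_lintegral _ _).trans_lt hu2.lintegral_enorm_sq_lt_top).ne
  -- The slab is the difference of two half-spaces that are translates of each other by `t e`. Its
  -- mass therefore compares `u²` with a translate of `u²` on one half-space, which Cauchy–Schwarz
  -- controls.
  have hsplit : ∫⁻ x in S ∩ {x | x i < b}, ‖u x‖ₑ ^ 2
      = (∫⁻ x in S ∩ {x | x i < a}, ‖u x‖ₑ ^ 2)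
        + ∫⁻ x in S ∩ {x | a ≤ x i ∧ x i < b}, ‖u x‖ₑ ^ 2 := by
    rw [← lintegral_union]
    · congr 2
      ext x
      simp only [Set.mem_inter_iff, Set.mem_ofPred_eq, Set.mem_union]
      constructor
      · rintro ⟨h1, h2⟩
        by_cases h3 : x i < a
        · exact Or.inl ⟨h1, h3⟩
        · exact Or.inr ⟨h1, not_lt.1 h3, h2⟩
      · rintro (⟨h1, h2⟩ | ⟨h1, -, h2⟩)
        · exact ⟨h1, h2.trans_le hab⟩
        · exact ⟨h1, h2⟩
    · exact hS.inter ((measurableSet_le measurable_const hcoord).inter hB)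
    · rw [Set.disjoint_left]
      rintro x ⟨-, h1⟩ ⟨-, h2, -⟩
      exact absurd h1 (not_lt.2 h2)
  have hshiftA : ∫⁻ x in S ∩ {x | x i < b}, ‖u (x + (-t) • e)‖ₑ ^ 2
      = ∫⁻ x in S ∩ {x | x i < a}, ‖u x‖ₑ ^ 2 := by
    refine htr _ _ (hS.inter hB) (hS.inter hA) fun x => ?_
    simp only [Set.mem_inter_iff, hinv, Set.mem_ofPred_eq]
    have : (x + (-t) • e) i = x i - t := by simp [he, sub_eq_add_neg]
    rw [this, ht]
    constructor
    · rintro ⟨h1, h2⟩; exact ⟨h1, by linarith⟩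
    · rintro ⟨h1, h2⟩; exact ⟨h1, by linarith⟩
  have hpt : ∀ x, ‖u x‖ₑ ^ 2 ≤ ‖u (x + (-t) • e)‖ₑ ^ 2
      + (‖u (x + (-t) • e) - u x‖ₑ * ‖u x‖ₑ
        + ‖u (x + (-t) • e) - u x‖ₑ * ‖u (x + (-t) • e)‖ₑ) := by
    intro x
    simp only [enorm_eq_nnnorm]
    norm_cast
    rw [← NNReal.coe_le_coe]
    push_cast
    simp only [Real.norm_eq_abs]
    rw [← abs_mul, ← abs_mul, sq_abs, sq_abs]
    generalize u (x + (-t) • e) = y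
    generalize u x = z
    have h1 := neg_abs_le ((y - z) * z)
    have h2 := neg_abs_le ((y - z) * y)
    nlinarith
  have hhol : ∀ w : R3 → ℝ, Measurable w → ∫⁻ x in S, ‖u (x + (-t) • e) - u x‖ₑ * ‖w x‖ₑ
      ≤ C * ENNReal.ofReal t * (∫⁻ x in S, ‖w x‖ₑ ^ 2) ^ (1 / 2 : ℝ) := by
    intro w hw
    have h1 := ENNReal.lintegral_mul_le_Lp_mul_Lq (volume.restrict S) Real.HolderConjugate.two_two
      (f := fun x => ‖u (x + (-t) • e) - u x‖ₑ) (g := fun x => ‖w x‖ₑ)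
      (hshift.sub hu).enorm.aemeasurable hw.enorm.aemeasurable
    simp only [Pi.mul_apply, ENNReal.rpow_ofNat] at h1
    refine h1.trans (mul_le_mul_left ?_ _)
    have h2 := hC (-t)
    rw [eLpNorm_two_eq] at h2
    have h3 : ‖-t‖ₑ = ENNReal.ofReal t := by
      rw [enorm_neg, Real.enorm_eq_ofReal_abs, abs_of_nonneg (by linarith)]
    rw [h3] at h2
    refine le_trans ?_ h2
    exact ENNReal.rpow_le_rpow (setLIntegral_le_lintegral _ _) (by norm_num)
  have hsub : ∀ f : R3 → ℝ≥0∞, ∫⁻ x in S ∩ {x | x i < b}, f x ≤ ∫⁻ x in S, f x := fun f =>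
    lintegral_mono_set Set.inter_subset_left
  have hSS := htr S S hS hS fun x => hinv (-t) x
  have hfinal : ∫⁻ x in S ∩ {x | x i < b}, ‖u x‖ₑ ^ 2
      ≤ (∫⁻ x in S ∩ {x | x i < a}, ‖u x‖ₑ ^ 2)
        + 2 * C * ENNReal.ofReal t * (∫⁻ x in S, ‖u x‖ₑ ^ 2) ^ (1 / 2 : ℝ) := by
    calc _ ≤ _ := lintegral_mono hpt
      _ = (∫⁻ x in S ∩ {x | x i < b}, ‖u (x + (-t) • e)‖ₑ ^ 2)
          + ((∫⁻ x in S ∩ {x | x i < b}, ‖u (x + (-t) • e) - u x‖ₑ * ‖u x‖ₑ)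
            + ∫⁻ x in S ∩ {x | x i < b}, ‖u (x + (-t) • e) - u x‖ₑ * ‖u (x + (-t) • e)‖ₑ) := by
          rw [lintegral_add_left (hshift.enorm.pow_const 2),
            lintegral_add_left (show Measurable fun x =>
              ‖u (x + (-t) • e) - u x‖ₑ * ‖u x‖ₑ from (hshift.sub hu).enorm.mul hu.enorm)]
      _ ≤ (∫⁻ x in S ∩ {x | x i < a}, ‖u x‖ₑ ^ 2)
          + (C * ENNReal.ofReal t * (∫⁻ x in S, ‖u x‖ₑ ^ 2) ^ (1 / 2 : ℝ)
            + C * ENNReal.ofReal t * (∫⁻ x in S, ‖u x‖ₑ ^ 2) ^ (1 / 2 : ℝ)) := by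
          rw [hshiftA]
          gcongr
          · exact (hsub _).trans (hhol u hu)
          · refine (hsub _).trans ((hhol _ hshift).trans_eq ?_)
            rw [hSS]
      _ = _ := by ring
  rw [hsplit] at hfinal
  exact (ENNReal.add_le_add_iff_left hfin).1 hfinal

/-- The slab bound is used twice. A slab in the first coordinate of thickness `3 s²` has mass
`O(s²)`; cutting it in the second coordinate gives `O(s²)` times the square root of that mass, hence
`s³`. In terms of the radius `r = s²` this is `r^{3/2}`, enough to integrate `1/r`. -/
theorem exists_lintegral_closedBall_le {u : R3 → ℝ} (hu : Measurable u) (hu2 : MemLp u 2 volume)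
    (hl : ∀ v, LipTranslates v u) : ∃ K : NNReal, ∀ (c : R3) (s : ℝ), 0 ≤ s →
      ∫⁻ x in Metric.closedBall c (s ^ 2), ‖u x‖ₑ ^ 2 ≤ K * ENNReal.ofReal s ^ 3 := by
  obtain ⟨C₀, h₀⟩ := hl (EuclideanSpace.single 0 (1 : ℝ))
  obtain ⟨C₁, h₁⟩ := hl (EuclideanSpace.single 1 (1 : ℝ))
  set W : ℝ≥0∞ := (∫⁻ x, ‖u x‖ₑ ^ 2) ^ (1 / 2 : ℝ) with hW
  have hWtop : W ≠ ⊤ := ENNReal.rpow_ne_top_of_nonneg (by norm_num)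
    hu2.lintegral_enorm_sq_lt_top.ne
  set K : ℝ≥0∞ := 6 * C₁ * (6 * C₀ * W) ^ (1 / 2 : ℝ) with hK
  have hKtop : K ≠ ⊤ := by
    refine ENNReal.mul_ne_top (by finiteness) (ENNReal.rpow_ne_top_of_nonneg (by norm_num) ?_)
    finiteness
  refine ⟨K.toNNReal, fun c s hs => ?_⟩
  rw [ENNReal.coe_toNNReal hKtop]
  have hnn : ENNReal.ofReal (c 0 + 2 * s ^ 2 - (c 0 - s ^ 2)) = 3 * ENNReal.ofReal s ^ 2 := by
    rw [show c 0 + 2 * s ^ 2 - (c 0 - s ^ 2) = 3 * s ^ 2 by ring, ENNReal.ofReal_mul (by norm_num),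
      ENNReal.ofReal_pow hs]
    simp
  have hnn1 : ENNReal.ofReal (c 1 + 2 * s ^ 2 - (c 1 - s ^ 2)) = 3 * ENNReal.ofReal s ^ 2 := by
    rw [show c 1 + 2 * s ^ 2 - (c 1 - s ^ 2) = 3 * s ^ 2 by ring, ENNReal.ofReal_mul (by norm_num),
      ENNReal.ofReal_pow hs]
    simp
  rcases hs.eq_or_lt with rfl | hs'
  · simp
  set S : Set R3 := {x | c 0 - s ^ 2 ≤ x 0 ∧ x 0 < c 0 + 2 * s ^ 2} with hSdef
  have hcoord : Measurable fun x : R3 => x 0 := by fun_prop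
  have hS : MeasurableSet S := (measurableSet_le measurable_const hcoord).inter
    (measurableSet_lt hcoord measurable_const)
  have s1 := lintegral_slab_le hu hu2 h₀ .univ (fun _ _ => by simp)
    (show c 0 - s ^ 2 ≤ c 0 + 2 * s ^ 2 by nlinarith)
  have s2 := lintegral_slab_le hu hu2 h₁ hS (fun t x => by simp [hSdef])
    (show c 1 - s ^ 2 ≤ c 1 + 2 * s ^ 2 by nlinarith)
  rw [Set.univ_inter, Measure.restrict_univ, hnn] at s1
  rw [hnn1] at s2
  calc ∫⁻ x in Metric.closedBall c (s ^ 2), ‖u x‖ₑ ^ 2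
      ≤ ∫⁻ x in S ∩ {x | c 1 - s ^ 2 ≤ x 1 ∧ x 1 < c 1 + 2 * s ^ 2}, ‖u x‖ₑ ^ 2 := by
        refine lintegral_mono_set fun x hx => ?_
        have hb : ∀ i : Fin 3, |x i - c i| ≤ s ^ 2 := fun i => by
          have h1 := PiLp.norm_apply_le (x - c) i
          rw [Metric.mem_closedBall, dist_eq_norm] at hx
          exact (by simpa using h1 : |x i - c i| ≤ ‖x - c‖).trans hx
        have hp : 0 < s ^ 2 := by positivity
        have h0 := abs_le.1 (hb 0)
        have h1 := abs_le.1 (hb 1)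
        exact ⟨⟨by linarith, by linarith⟩, ⟨by linarith, by linarith⟩⟩
    _ ≤ 2 * C₁ * (3 * ENNReal.ofReal s ^ 2)
        * (2 * C₀ * (3 * ENNReal.ofReal s ^ 2) * W) ^ (1 / 2 : ℝ) := by
        refine s2.trans ?_
        gcongr
    _ = 2 * C₁ * (3 * ENNReal.ofReal s ^ 2)
        * ((6 * C₀ * W) ^ (1 / 2 : ℝ) * ENNReal.ofReal s) := by
        congr 1
        rw [show 2 * (C₀ : ℝ≥0∞) * (3 * ENNReal.ofReal s ^ 2) * W
          = (6 * C₀ * W) * ENNReal.ofReal s ^ 2 by ring, ENNReal.mul_rpow_of_nonneg _ _ (by norm_num)]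
        congr 1
        rw [← ENNReal.rpow_natCast, ← ENNReal.rpow_mul]
        norm_num
    _ = K * ENNReal.ofReal s ^ 3 := by rw [hK]; ring

/-- A point with `‖z‖ < s²` lies in some shell `s² / 4^(k+1) < ‖z‖ ≤ s² / 4^k`, where `1/‖z‖` is at
most the value attached to the `k`-th ball. -/
theorem enorm_inv_le_dyadic {z : R3} (hz : z ≠ 0) {s : ℝ} (hs : 0 < s) :
    ‖z‖ₑ⁻¹ ≤ (ENNReal.ofReal (s ^ 2))⁻¹ + ∑' k : ℕ,
      (if ‖z‖ ≤ (s / 2 ^ k) ^ 2 then ENNReal.ofReal (4 ^ (k + 1) / s ^ 2) else 0) := by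
  have hz0 : 0 < ‖z‖ := norm_pos_iff.2 hz
  rw [← ofReal_norm]
  by_cases h : s ^ 2 ≤ ‖z‖
  · refine le_add_right ?_
    gcongr
  · refine le_add_left ?_
    obtain ⟨k, hk1, hk2⟩ := exists_nat_pow_near (x := s ^ 2 / ‖z‖) (y := 4)
      ((one_le_div hz0).2 (not_le.1 h).le) (by norm_num)
    refine le_trans ?_ (ENNReal.le_tsum k)
    have h4 : (4 : ℝ) ^ k = (2 ^ k) ^ 2 := by rw [← pow_mul, mul_comm, pow_mul]; norm_num
    rw [if_pos, ← ENNReal.ofReal_inv_of_pos hz0]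
    · refine ENNReal.ofReal_le_ofReal ?_
      rw [div_lt_iff₀ hz0] at hk2
      rw [inv_eq_one_div, div_le_div_iff₀ hz0 (by positivity)]
      linarith
    · rw [le_div_iff₀ hz0] at hk1
      rw [div_pow, le_div_iff₀ (by positivity), ← h4]
      linarith

/-- Uniform bound on the Coulomb potential of a density dominated by an `H¹` density. -/
theorem exists_potential_le {u : R3 → ℝ} (hu : Measurable u) (hu2 : MemLp u 2 volume)
    (hl : ∀ v, LipTranslates v u) : ∃ K : NNReal, ∀ (g : R3 → ℝ≥0∞) (a : ℝ≥0∞), Measurable g →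
      (∀ x, g x ≤ a * ‖u x‖ₑ ^ 2) → ∀ (c : R3) (s : ℝ), 0 < s →
      ∫⁻ y, ‖y - c‖ₑ⁻¹ * g y
        ≤ (ENNReal.ofReal (s ^ 2))⁻¹ * (∫⁻ y, g y) + a * (K * ENNReal.ofReal s) := by
  obtain ⟨K, hK⟩ := exists_lintegral_closedBall_le hu hu2 hl
  -- The `k`-th ball contributes at most `(4^(k+1) / s²) · a K (s / 2^k)³ = 4 a K s / 2^k`, and the
  -- geometric series doubles the factor 4.
  refine ⟨8 * K, fun g a hg hga c s hs => ?_⟩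
  have hmB : ∀ k : ℕ, MeasurableSet (Metric.closedBall c ((s / 2 ^ k) ^ 2)) := fun k =>
    Metric.isClosed_closedBall.measurableSet
  have h1 : ∀ᵐ y : R3, ‖y - c‖ₑ⁻¹ * g y ≤ (ENNReal.ofReal (s ^ 2))⁻¹ * g y
      + ∑' k : ℕ, (Metric.closedBall c ((s / 2 ^ k) ^ 2)).indicator
        (fun y => ENNReal.ofReal (4 ^ (k + 1) / s ^ 2) * g y) y := by
    have hne : ∀ᵐ y : R3, y ≠ c := by simp [ae_iff]
    filter_upwards [hne] with y hy
    refine (mul_le_mul_left (enorm_inv_le_dyadic (sub_ne_zero.2 hy) hs) _).trans_eq ?_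
    rw [add_mul, ← ENNReal.tsum_mul_right]
    congr 2; ext k
    by_cases h : ‖y - c‖ ≤ (s / 2 ^ k) ^ 2
    · rw [if_pos h, Set.indicator_of_mem (by simpa [dist_eq_norm] using h)]
    · rw [if_neg h, Set.indicator_of_notMem (by simpa [dist_eq_norm] using h), zero_mul]
  refine (lintegral_mono_ae h1).trans ?_
  rw [lintegral_add_left (hg.const_mul _), lintegral_const_mul _ hg,
    lintegral_tsum fun k => ((hg.const_mul _).indicator (hmB k)).aemeasurable]
  gcongr
  have hterm : ∀ k : ℕ, ∫⁻ y, (Metric.closedBall c ((s / 2 ^ k) ^ 2)).indicator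
        (fun y => ENNReal.ofReal (4 ^ (k + 1) / s ^ 2) * g y) y
      ≤ (4 * a * K * ENNReal.ofReal s) * (2⁻¹ : ℝ≥0∞) ^ k := by
    intro k
    rw [lintegral_indicator (hmB k), lintegral_const_mul _ hg]
    calc ENNReal.ofReal (4 ^ (k + 1) / s ^ 2) * ∫⁻ y in Metric.closedBall c ((s / 2 ^ k) ^ 2), g y
        ≤ ENNReal.ofReal (4 ^ (k + 1) / s ^ 2) * (a * (K * ENNReal.ofReal (s / 2 ^ k) ^ 3)) := by
          gcongr
          refine (lintegral_mono hga).trans ?_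
          rw [lintegral_const_mul _ (hu.enorm.pow_const 2)]
          gcongr
          exact hK c _ (by positivity)
      _ = a * K * (ENNReal.ofReal (4 ^ (k + 1) / s ^ 2) * ENNReal.ofReal (s / 2 ^ k) ^ 3) := by
          ring
      _ = a * K * (4 * ENNReal.ofReal s * (2⁻¹ : ℝ≥0∞) ^ k) := by
          congr 1
          have h2 : (2⁻¹ : ℝ≥0∞) = ENNReal.ofReal (2⁻¹) := by
            rw [ENNReal.ofReal_inv_of_pos two_pos]; simp
          have h4 : (4 : ℝ≥0∞) = ENNReal.ofReal 4 := by simp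
          rw [h2, h4, ← ENNReal.ofReal_pow (by positivity), ← ENNReal.ofReal_pow (by positivity),
            ← ENNReal.ofReal_mul (by positivity), ← ENNReal.ofReal_mul (by positivity),
            ← ENNReal.ofReal_mul (by positivity)]
          congr 1
          have h4 : (4 : ℝ) ^ k = (2 ^ k) ^ 2 := by rw [← pow_mul, mul_comm, pow_mul]; norm_num
          rw [pow_succ, h4, inv_pow]
          field_simp
      _ = _ := by ring
  refine (ENNReal.tsum_le_tsum hterm).trans_eq ?_
  rw [ENNReal.tsum_mul_left, ENNReal.tsum_geometric, ENNReal.one_sub_inv_two, inv_inv]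
  push_cast
  ring

theorem lintegral_config_insertNth {n : ℕ} {F : Config (n + 1) → ℝ≥0∞} (hF : Measurable F)
    (i : Fin (n + 1)) :
    ∫⁻ x, F x = ∫⁻ y : Config n, ∫⁻ x₁ : R3, F (i.insertNth x₁ y) := by
  have hp := (volume_preserving_piFinSuccAbove (fun _ : Fin (n + 1) => R3) i).symm
  rw [← hp.lintegral_comp_emb (MeasurableEquiv.measurableEmbedding _), Measure.volume_eq_prod,
    lintegral_prod_symm']
  · rfl
  · exact hF.comp (MeasurableEquiv.measurable _)

/-- Interaction energy of a product density with bounded Coulomb potential. -/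
theorem lintegral_coulomb_mul_prod_le {n : ℕ} {g : R3 → ℝ≥0∞} (hg : Measurable g)
    (h1 : ∫⁻ y, g y = 1) {B : ℝ≥0∞} (hB : ∀ c, ∫⁻ y, ‖y - c‖ₑ⁻¹ * g y ≤ B) :
    ∫⁻ x : Config (n + 1), coulomb x * ∏ i, g (x i) ≤ (n + 1 : ℕ) ^ 2 * B := by
  have hP : Measurable fun x : Config (n + 1) => ∏ i, g (x i) :=
    measurable_config_prod fun _ => hg
  -- With all other particles frozen, integrating the `i`-th variable gives a potential bounded by
  -- `B`; what is left has total mass one.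
  have hpair : ∀ i j : Fin (n + 1), j ≠ i →
      ∫⁻ x : Config (n + 1), ‖x i - x j‖ₑ⁻¹ * ∏ l, g (x l) ≤ B := by
    intro i j hij
    obtain ⟨j', rfl⟩ := Fin.exists_succAbove_eq hij
    rw [lintegral_config_insertNth (by fun_prop) i]
    have hin : ∀ y : Config n, ∫⁻ x₁ : R3,
        ‖(i.insertNth x₁ y : Config (n + 1)) i
          - (i.insertNth x₁ y : Config (n + 1)) (i.succAbove j')‖ₑ⁻¹
          * ∏ l, g ((i.insertNth x₁ y : Config (n + 1)) l) ≤ B * ∏ l, g (y l) := by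
      intro y
      simp only [Fin.prod_univ_succAbove _ i, Fin.insertNth_apply_same,
        Fin.insertNth_apply_succAbove, ← mul_assoc]
      rw [lintegral_mul_const _ (by fun_prop)]
      gcongr
      exact hB _
    refine (lintegral_mono hin).trans ?_
    rw [lintegral_const_mul _ (measurable_config_prod fun _ => hg),
      lintegral_config_prod fun _ => hg]
    simp [h1]
  unfold coulomb
  simp_rw [Finset.sum_mul]
  rw [lintegral_finsetSum _ fun i _ => Finset.measurable_fun_sum _ fun j _ => by fun_prop]
  have hi : ∀ i : Fin (n + 1), ∫⁻ x : Config (n + 1),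
      ∑ j ∈ Finset.Ioi i, ‖x i - x j‖ₑ⁻¹ * ∏ l, g (x l) ≤ (n + 1 : ℕ) * B := by
    intro i
    rw [lintegral_finsetSum _ fun j _ => by fun_prop]
    refine (Finset.sum_le_card_nsmul _ _ B fun j hj =>
      hpair i j (Finset.mem_Ioi.1 hj).ne').trans ?_
    rw [nsmul_eq_mul]
    gcongr
    exact (Finset.card_le_univ _).trans (by simp)
  refine (Finset.sum_le_card_nsmul _ _ _ fun i _ => hi i).trans_eq ?_
  rw [nsmul_eq_mul, Finset.card_univ, Fintype.card_fin]
  ring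

/-! ### Periodic arches -/

section Arch

variable {N : ℕ}

/-- One of `N` arches of `|sin (π N s)|` per period. -/
def arch (N : ℕ) (s : ℝ) : ℝ :=
  if Int.fract s < 1 / N then |Real.sin (Real.pi * N * s)| else 0

theorem abs_arch_le_one (s : ℝ) : |arch N s| ≤ 1 := by
  unfold arch
  split_ifs
  · rw [abs_abs]; exact Real.abs_sin_le_one _
  · simp

/-- Cutting `|sin|` off at its zeros keeps its Lipschitz constant. -/
theorem abs_arch_sub_le (hN : 0 < N) (s t : ℝ) :
    |arch N s - arch N t| ≤ Real.pi * N * |s - t| := by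
  have hN' : (0 : ℝ) < N := by exact_mod_cast hN
  have hsin : ∀ p q : ℝ, |Real.sin (Real.pi * N * p) - Real.sin (Real.pi * N * q)|
      ≤ Real.pi * N * |p - q| := fun p q => by
    refine (Real.abs_sin_sub_sin_le _ _).trans_eq ?_
    rw [← mul_sub, abs_mul, abs_of_pos (by positivity)]
  have hone : ∀ p q : ℝ, Int.fract p < 1 / N → ¬ Int.fract q < 1 / N →
      |Real.sin (Real.pi * N * p)| ≤ Real.pi * N * |p - q| := by
    intro p q hp hq
    -- From `p` inside the arch to `q` outside, an endpoint of the arch is crossed: the left one if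
    -- `q < ⌊p⌋`, the right one otherwise. The sine vanishes there.
    have hz : ∃ r : ℝ, Real.sin (Real.pi * N * r) = 0 ∧ |p - r| ≤ |p - q| := by
      have hp0 := Int.fract_nonneg p
      have hpe := Int.floor_add_fract p
      rcases lt_or_ge q ⌊p⌋ with h | h
      · refine ⟨⌊p⌋, ?_, ?_⟩
        · rw [show Real.pi * N * (⌊p⌋ : ℝ) = ((N * ⌊p⌋ : ℤ) : ℝ) * Real.pi by push_cast; ring]
          exact Real.sin_int_mul_pi _
        · rw [abs_of_nonneg (by linarith), abs_of_nonneg (by linarith)]; linarith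
      · have h2 : (⌊p⌋ : ℝ) + 1 / N ≤ q := by
          by_contra! h3
          have h1N : (1 : ℝ) / N ≤ 1 := by
            rw [div_le_one hN']; exact_mod_cast hN
          have hf : ⌊q⌋ = ⌊p⌋ := Int.floor_eq_iff.2 ⟨h, by linarith⟩
          refine hq ?_
          rw [Int.fract, hf]; linarith
        refine ⟨⌊p⌋ + 1 / N, ?_, ?_⟩
        · rw [show Real.pi * N * ((⌊p⌋ : ℝ) + 1 / N) = ((N * ⌊p⌋ + 1 : ℤ) : ℝ) * Real.pi by
            push_cast; field_simp]
          exact Real.sin_int_mul_pi _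
        · rw [abs_of_nonpos (by linarith), abs_of_nonpos (by linarith)]; linarith
    obtain ⟨r, hr, hpr⟩ := hz
    have := hsin p r
    rw [hr, sub_zero] at this
    exact this.trans (by gcongr)
  unfold arch
  split_ifs with hs ht ht
  · exact (abs_abs_sub_abs_le_abs_sub _ _).trans (hsin s t)
  · rw [sub_zero, abs_abs]; exact hone s t hs ht
  · rw [zero_sub, abs_neg, abs_abs, abs_sub_comm s t]; exact hone t s ht hs
  · simp; positivity

theorem continuous_arch (hN : 0 < N) : Continuous (arch N) := by
  have : LipschitzWith (Real.toNNReal (Real.pi * N)) (arch N) :=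
    LipschitzWith.of_dist_le_mul fun s t => by
      rw [Real.coe_toNNReal _ (by positivity)]
      exact abs_arch_sub_le hN s t
  exact this.continuous

theorem arch_periodic : Function.Periodic (arch N) 1 := by
  intro s
  unfold arch
  rw [Int.fract_add_one, show Real.pi * N * (s + 1) = Real.pi * N * s + N * Real.pi by ring]
  congr 1
  rw [Real.sin_add_nat_mul_pi, abs_mul, abs_pow, abs_neg, abs_one, one_pow, one_mul]

/-- The `N` translates by `j / N` tile the period, so exactly one of them is active at `s`.
Disjointness of the arches and the formula for the sum of their squares both follow. -/
theorem fract_sub_div_lt_iff (hN : 0 < N) (s : ℝ) (j : Fin N) :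
    Int.fract (s - (j : ℕ) / N) < 1 / N ↔ ((j : ℕ) : ℤ) = ⌊N * Int.fract s⌋ := by
  have hN' : (0 : ℝ) < N := by exact_mod_cast hN
  have h0 := Int.fract_nonneg s
  have h1 := Int.fract_lt_one s
  have hj : ((j : ℕ) : ℝ) + 1 ≤ N := by exact_mod_cast j.2
  have hj0 : (0 : ℝ) ≤ (j : ℕ) := by positivity
  have he : Int.fract (s - (j : ℕ) / N) = Int.fract (Int.fract s - (j : ℕ) / N) := by
    conv_lhs => rw [← Int.floor_add_fract s, add_sub_assoc, Int.fract_intCast_add]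
  rw [he, eq_comm, Int.floor_eq_iff]
  have hdiv : ((j : ℕ) : ℝ) / N + 1 / N ≤ 1 := by
    rw [← add_div, div_le_one hN']; exact hj
  have hdiv0 : (0 : ℝ) ≤ ((j : ℕ) : ℝ) / N := by positivity
  have hdivp : (0 : ℝ) < 1 / N := by positivity
  have hr : ∀ c : ℝ, c / N ≤ Int.fract s ↔ c ≤ N * Int.fract s := fun c => by
    rw [div_le_iff₀ hN', mul_comm]
  by_cases hc : ((j : ℕ) : ℝ) / N ≤ Int.fract s
  · have hfl : Int.fract (Int.fract s - (j : ℕ) / N) = Int.fract s - (j : ℕ) / N :=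
      Int.fract_eq_self.2 ⟨by linarith, by linarith⟩
    rw [hfl]
    have e2 := hr ((j : ℕ) + 1)
    rw [add_div] at e2
    push_cast
    constructor
    · intro h
      refine ⟨(hr _).1 hc, ?_⟩
      by_contra! h3
      have := e2.2 h3
      linarith
    · rintro ⟨-, h⟩
      by_contra! h3
      have := e2.1 (by linarith)
      linarith
  · have hfl : Int.fract (Int.fract s - (j : ℕ) / N) = Int.fract s - (j : ℕ) / N + 1 := by
      rw [← Int.fract_add_one]
      exact Int.fract_eq_self.2 ⟨by linarith, by linarith⟩
    rw [hfl]
    push_cast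
    constructor
    · intro h; linarith
    · rintro ⟨h, -⟩; exact absurd ((hr _).2 h) hc

theorem arch_mul_arch (hN : 0 < N) (s : ℝ) {i j : Fin N} (hij : i ≠ j) :
    arch N (s - (i : ℕ) / N) * arch N (s - (j : ℕ) / N) = 0 := by
  unfold arch
  split_ifs with h1 h2
  · rw [fract_sub_div_lt_iff hN] at h1 h2
    exact absurd (Fin.ext (by exact_mod_cast h1.trans h2.symm)) hij
  all_goals simp

theorem sum_arch_sq (hN : 0 < N) (s : ℝ) :
    ∑ j : Fin N, arch N (s - (j : ℕ) / N) ^ 2 = Real.sin (Real.pi * N * s) ^ 2 := by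
  have hN' : (0 : ℝ) < N := by exact_mod_cast hN
  have h0 := Int.fract_nonneg s
  have h1 := Int.fract_lt_one s
  have hfl0 : 0 ≤ ⌊N * Int.fract s⌋ := Int.floor_nonneg.2 (by positivity)
  have hflN : ⌊N * Int.fract s⌋ < N := by
    rw [Int.floor_lt]; push_cast; nlinarith
  set j₀ : Fin N := ⟨⌊N * Int.fract s⌋.toNat, by omega⟩ with hj₀
  have hj₀' : ((j₀ : ℕ) : ℤ) = ⌊N * Int.fract s⌋ := by simp [hj₀, hfl0]
  rw [Finset.sum_eq_single j₀]
  · unfold arch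
    rw [if_pos ((fract_sub_div_lt_iff hN s j₀).2 hj₀'), sq_abs,
      show Real.pi * N * (s - (j₀ : ℕ) / N) = Real.pi * N * s - (j₀ : ℕ) * Real.pi by
        field_simp, Real.sin_sub_nat_mul_pi, mul_pow, ← pow_mul, mul_comm (j₀ : ℕ) 2, pow_mul]
    simp
  · intro j _ hj
    unfold arch
    rw [if_neg fun h => hj (Fin.ext (by
      exact_mod_cast ((fract_sub_div_lt_iff hN s j).1 h).trans hj₀'.symm))]
    simp
  · simp

/-- The second family is shifted by half an arch, which turns `sin²` into `cos²`. -/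
theorem sum_sum_arch_sq (hN : 0 < N) (s : ℝ) :
    ∑ a : Fin 2, ∑ j : Fin N, arch N (s - (a : ℕ) / (2 * N) - (j : ℕ) / N) ^ 2 = 1 := by
  have hN' : (0 : ℝ) < N := by exact_mod_cast hN
  simp_rw [sum_arch_sq hN]
  rw [Fin.sum_univ_two]
  simp only [Fin.val_zero, Fin.val_one, Nat.cast_zero, Nat.cast_one, zero_div, sub_zero]
  rw [show Real.pi * N * (s - 1 / (2 * N)) = Real.pi * N * s - Real.pi / 2 by field_simp,
    Real.sin_sub_pi_div_two, neg_sq]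
  exact Real.sin_sq_add_cos_sq _

/-- By periodicity all `2 N` translates have the same integral, and together they integrate to one.
-/
theorem integral_arch_sq (hN : 0 < N) (c : ℝ) :
    ∫ s in (0 : ℝ)..1, arch N (s - c) ^ 2 = 1 / (2 * N) := by
  have hN' : (0 : ℝ) < N := by exact_mod_cast hN
  have hI : ∀ c : ℝ, ∫ s in (0 : ℝ)..1, arch N (s - c) ^ 2 = ∫ s in (0 : ℝ)..1, arch N s ^ 2 := by
    intro c
    have hper : Function.Periodic (fun s => arch N s ^ 2) 1 := fun s => by
      simp only [arch_periodic s]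
    rw [intervalIntegral.integral_comp_sub_right (fun s => arch N s ^ 2) c]
    have := hper.intervalIntegral_add_eq (0 - c) 0
    rw [show (1 : ℝ) - c = 0 - c + 1 by ring, this, zero_add]
  have hsum : ∫ s in (0 : ℝ)..1, ∑ a : Fin 2, ∑ j : Fin N,
      arch N (s - (a : ℕ) / (2 * N) - (j : ℕ) / N) ^ 2 = 1 := by
    simp_rw [sum_sum_arch_sq hN]; simp
  have hcont : ∀ c : ℝ, Continuous fun s => arch N (s - c) ^ 2 := fun c =>
    ((continuous_arch hN).comp (continuous_id.sub continuous_const)).pow 2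
  have hcont2 : ∀ (a : Fin 2) (j : Fin N),
      Continuous fun s : ℝ => arch N (s - (a : ℕ) / (2 * N) - (j : ℕ) / N) ^ 2 := fun a j => by
    simp_rw [sub_sub]; exact hcont _
  rw [intervalIntegral.integral_finsetSum fun a _ =>
    (continuous_finsetSum _ fun j _ => hcont2 a j).intervalIntegrable _ _] at hsum
  simp_rw [intervalIntegral.integral_finsetSum fun j (_ : j ∈ Finset.univ) =>
    (hcont2 _ j).intervalIntegrable _ _, sub_sub, hI] at hsum
  simp only [Finset.sum_const, Finset.card_univ, Fintype.card_fin, nsmul_eq_mul] at hsum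
  rw [hI, eq_div_iff (by positivity)]
  push_cast at hsum
  linarith

end Arch

/-! ### Transport to the uniform distribution -/

section Uniform

open ProbabilityTheory

/-- Probability integral transform. Continuity suffices: the intermediate value theorem supplies
quantiles, and no strict monotonicity is needed. -/
theorem map_cdf_eq_volume (m : Measure ℝ) [IsProbabilityMeasure m] (hc : Continuous (cdf m)) :
    m.map (cdf m) = volume.restrict (Set.Ioc 0 1) := by
  have : IsProbabilityMeasure (m.map (cdf m)) := Measure.isProbabilityMeasure_map hc.aemeasurable
  have hivt : ∀ s : ℝ, 0 < s → s < 1 → ∃ t, cdf m t = s := by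
    intro s h0 h1
    obtain ⟨a, ha⟩ := ((tendsto_cdf_atBot m).eventually (gt_mem_nhds h0)).exists
    obtain ⟨b, hb⟩ := ((tendsto_cdf_atTop m).eventually (lt_mem_nhds h1)).exists
    exact mem_range_of_exists_le_of_exists_ge hc ⟨a, ha.le⟩ ⟨b, hb.le⟩
  refine Measure.ext_of_Iic _ _ fun s => ?_
  rw [Measure.map_apply hc.measurable measurableSet_Iic, Measure.restrict_apply measurableSet_Iic]
  have hv : volume (Set.Iic s ∩ Set.Ioc 0 1) = ENNReal.ofReal (min s 1) := by
    rw [Set.inter_comm, Set.Ioc_inter_Iic, Real.volume_Ioc, sub_zero, inf_comm]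
  rw [hv]
  rcases lt_or_ge s 0 with hs | hs
  · have : cdf m ⁻¹' Set.Iic s = ∅ := by
      ext t
      simp only [Set.mem_preimage, Set.mem_Iic, Set.mem_empty_iff_false, iff_false, not_le]
      exact hs.trans_le (cdf_nonneg m t)
    rw [this, measure_empty, ENNReal.ofReal_of_nonpos (by rw [min_le_iff]; exact Or.inl hs.le)]
  rcases le_or_gt 1 s with hs1 | hs1
  · have : cdf m ⁻¹' Set.Iic s = Set.univ := by
      ext t
      simp only [Set.mem_preimage, Set.mem_Iic, Set.mem_univ, iff_true]
      exact (cdf_le_one m t).trans hs1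
    rw [this, measure_univ, min_eq_right hs1, ENNReal.ofReal_one]
  rw [min_eq_left hs1.le]
  refine le_antisymm ?_ ?_
  · refine ENNReal.le_of_forall_pos_le_add fun ε hε _ => ?_
    -- The level must exceed `s`, because `cdf` may be flat at height `s`, and stay below 1 so that
    -- it is attained.
    have h2 : s < min (s + ε) ((s + 1) / 2) :=
      lt_min (by have : (0 : ℝ) < ε := hε
                 linarith) (by linarith)
    obtain ⟨t, ht⟩ := hivt (min (s + ε) ((s + 1) / 2)) (hs.trans_lt h2)
      ((min_le_right _ _).trans_lt (by linarith))
    have hsub : cdf m ⁻¹' Set.Iic s ⊆ Set.Iic t := by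
      intro r hr
      simp only [Set.mem_preimage, Set.mem_Iic] at hr ⊢
      by_contra! h3
      have := monotone_cdf m h3.le
      linarith
    calc m (cdf m ⁻¹' Set.Iic s) ≤ m (Set.Iic t) := measure_mono hsub
      _ = ENNReal.ofReal (min (s + ε) ((s + 1) / 2)) := by rw [← ht, ofReal_cdf]
      _ ≤ ENNReal.ofReal (s + ε) := ENNReal.ofReal_le_ofReal (min_le_left _ _)
      _ = _ := by rw [ENNReal.ofReal_add hs (by positivity), ENNReal.ofReal_coe_nnreal]
  · rcases hs.eq_or_lt with rfl | hs0
    · simp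
    obtain ⟨t, ht⟩ := hivt s hs0 hs1
    calc ENNReal.ofReal s = m (Set.Iic t) := by rw [← ht, ofReal_cdf]
      _ ≤ _ := measure_mono fun r hr => by
        simp only [Set.mem_preimage, Set.mem_Iic] at hr ⊢
        exact (monotone_cdf m hr).trans ht.le

/-- A Lipschitz function whose law under the probability density `U²` is uniform. -/
theorem exists_lipschitz_uniform {U : R3 → ℝ} (hU : Measurable U) (hU2 : MemLp U 2 volume)
    (hl : ∀ v, LipTranslates v U) (h1 : ∫⁻ x, ENNReal.ofReal (U x ^ 2) = 1) :
    ∃ (G : R3 → ℝ) (L : NNReal), LipschitzWith L G ∧ ∀ f : ℝ → ℝ≥0∞, Measurable f →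
      ∫⁻ x, f (G x) * ENNReal.ofReal (U x ^ 2) = ∫⁻ s in Set.Ioc 0 1, f s := by
  obtain ⟨C, hC⟩ := hl (EuclideanSpace.single 0 (1 : ℝ))
  have hsq : ∀ x, ‖U x‖ₑ ^ 2 = ENNReal.ofReal (U x ^ 2) := fun x => by
    rw [Real.enorm_eq_ofReal_abs, ← ENNReal.ofReal_pow (abs_nonneg _), sq_abs]
  have hmU : Measurable fun x => ENNReal.ofReal (U x ^ 2) := (hU.pow_const 2).ennreal_ofReal
  have hcoord : Measurable fun x : R3 => x 0 := by fun_prop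
  set ν : Measure R3 := volume.withDensity fun x => ENNReal.ofReal (U x ^ 2) with hν
  have : IsProbabilityMeasure ν :=
    ⟨by rw [hν, withDensity_apply _ .univ, Measure.restrict_univ, h1]⟩
  set m : Measure ℝ := ν.map fun x => x 0 with hm
  have : IsProbabilityMeasure m := Measure.isProbabilityMeasure_map hcoord.aemeasurable
  -- The slab bound for a function of unit mass says that the law of the first coordinate has
  -- density at most `2 C`, so its distribution function is the Lipschitz function sought.
  have hslab : ∀ a b : ℝ, a ≤ b → m (Set.Ico a b) ≤ ENNReal.ofReal (2 * C * (b - a)) := by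
    intro a b hab
    have h := lintegral_slab_le hU hU2 hC .univ (fun _ _ => by simp) hab
    rw [Set.univ_inter, Measure.restrict_univ] at h
    simp_rw [hsq] at h
    rw [h1, ENNReal.one_rpow, mul_one] at h
    rw [hm, Measure.map_apply hcoord measurableSet_Ico, hν,
      withDensity_apply _ (hcoord measurableSet_Ico)]
    refine h.trans_eq ?_
    rw [ENNReal.ofReal_mul (by positivity), ENNReal.ofReal_mul (by norm_num)]
    simp
  have hcdf : ∀ a b : ℝ, a ≤ b → cdf m b - cdf m a ≤ 2 * C * (b - a) := by
    intro a b hab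
    -- Slabs are closed on the left and open on the right, whereas increments of `cdf` measure `Ioc
    -- a b`; the right end is enlarged by `η`, which then tends to zero.
    have hη : ∀ η : ℝ, 0 < η → cdf m b - cdf m a ≤ 2 * C * (b + η - a) := by
      intro η hη
      have h2 : m (Set.Ioc a b) ≤ ENNReal.ofReal (2 * C * (b + η - a)) :=
        (measure_mono (t := Set.Ico a (b + η)) fun x (hx : x ∈ Set.Ioc a b) =>
          ⟨hx.1.le, hx.2.trans_lt (by linarith)⟩).trans (hslab a (b + η) (by linarith))
      rw [← measure_cdf m, StieltjesFunction.measure_Ioc] at h2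
      exact (ENNReal.ofReal_le_ofReal_iff (by
        have : 0 ≤ b + η - a := by linarith
        positivity)).1 h2
    have ht : Tendsto (fun η : ℝ => 2 * C * (b + η - a)) (𝓝[>] 0) (𝓝 (2 * C * (b + 0 - a))) :=
      ((by fun_prop : Continuous fun η : ℝ => 2 * (C : ℝ) * (b + η - a)).tendsto 0).mono_left
        nhdsWithin_le_nhds
    rw [add_zero] at ht
    exact ge_of_tendsto ht (by filter_upwards [self_mem_nhdsWithin] with η h using hη η h)
  have hlip : LipschitzWith (2 * C) (cdf m) := LipschitzWith.of_dist_le_mul fun a b => by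
    rw [Real.dist_eq, Real.dist_eq]
    push_cast
    rcases le_total a b with h | h
    · rw [abs_sub_comm, abs_of_nonneg (sub_nonneg.2 (monotone_cdf m h)), abs_sub_comm,
        abs_of_nonneg (sub_nonneg.2 h)]
      exact hcdf a b h
    · rw [abs_of_nonneg (sub_nonneg.2 (monotone_cdf m h)), abs_of_nonneg (sub_nonneg.2 h)]
      exact hcdf b a h
  have hc1 : LipschitzWith 1 fun x : R3 => x 0 := LipschitzWith.of_dist_le_mul fun x y => by
    have := PiLp.norm_apply_le (x - y) 0
    simpa [dist_eq_norm] using this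
  refine ⟨fun x => cdf m (x 0), 2 * C * 1, hlip.comp hc1, fun f hf => ?_⟩
  have hfc : Measurable fun t => f (cdf m t) := hf.comp hlip.continuous.measurable
  have hfx : Measurable fun x : R3 => f (cdf m (x 0)) := hfc.comp hcoord
  have e : ∫⁻ t, f (cdf m t) ∂m = ∫⁻ x, f (cdf m (x 0)) * ENNReal.ofReal (U x ^ 2) := by
    conv_lhs => rw [hm]
    rw [lintegral_map hfc hcoord, hν,
      lintegral_withDensity_eq_lintegral_mul _ hmU hfx]
    exact lintegral_congr fun x => mul_comm _ _
  rw [← map_cdf_eq_volume m hlip.continuous, lintegral_map hf hlip.continuous.measurable, e]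

end Uniform

/-! ### Antisymmetric states with a prescribed density -/

/-- A family of orbitals whose superposition has density `δ U²`, for a probability density `U²`. -/
theorem exists_arch_slots {n : ℕ} {U : R3 → ℝ} (hU : Measurable U) (hU2 : MemLp U 2 volume)
    (hl : ∀ v, LipTranslates v U) (h1 : ∫⁻ x, ENNReal.ofReal (U x ^ 2) = 1) {δ : ℝ} (hδ : 0 ≤ δ) :
    ∃ (φ : Fin 2 → Fin (n + 1) → R3 → ℝ) (w : (Fin (n + 1) → Fin (n + 1)) → ℝ),
      (∀ a, IsSlot (φ a) w) ∧ (∀ a, IsSlot.Normalized (φ a) w) ∧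
      (∀ a j x, φ a j x ^ 2 ≤ 2 * (n + 1 : ℕ) * U x ^ 2) ∧ ∑ k, w k = δ / 2 ∧
      ∀ x, ∑ a, ∑ k, w k * φ a (k 0) x ^ 2 = δ * U x ^ 2 := by
  classical
  obtain ⟨G, L, hG, hunif⟩ := exists_lipschitz_uniform hU hU2 hl h1
  set N : ℕ := n + 1 with hN
  have hN0 : 0 < N := Nat.succ_pos n
  have hN' : (0 : ℝ) < N := by exact_mod_cast hN0
  -- The factor `√(2 N)` compensates the integral `1 / (2 N)` of a squared arch. Composition with
  -- `G` makes every orbital normalized.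
  set A : Fin 2 → Fin N → R3 → ℝ := fun a j x =>
    √(2 * N) * arch N (G x - ((a : ℕ) / (2 * N) + (j : ℕ) / N)) with hA
  have hAlip : ∀ a j, LipschitzWith
      (Real.toNNReal (√(2 * N) * (Real.pi * N * L))) (A a j) := fun a j =>
    LipschitzWith.of_dist_le_mul fun x y => by
      rw [Real.coe_toNNReal _ (by positivity), Real.dist_eq, hA]
      simp only
      rw [← mul_sub, abs_mul, abs_of_nonneg (Real.sqrt_nonneg _), mul_assoc (√(2 * N))]
      refine mul_le_mul_of_nonneg_left ?_ (Real.sqrt_nonneg _)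
      refine (abs_arch_sub_le hN0 _ _).trans ?_
      rw [sub_sub_sub_cancel_right, mul_assoc (Real.pi * N)]
      refine mul_le_mul_of_nonneg_left ?_ (by positivity)
      simpa [Real.dist_eq] using hG.dist_le_mul x y
  have hAb : ∀ a j x, |A a j x| ≤ (Real.toNNReal √(2 * N) : ℝ) := fun a j x => by
    rw [Real.coe_toNNReal _ (Real.sqrt_nonneg _), hA]
    simp only
    rw [abs_mul, abs_of_nonneg (Real.sqrt_nonneg _)]
    exact mul_le_of_le_one_right (Real.sqrt_nonneg _) (abs_arch_le_one _)
  have hsq : ∀ a j x, A a j x ^ 2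
      = 2 * N * arch N (G x - ((a : ℕ) / (2 * N) + (j : ℕ) / N)) ^ 2 := fun a j x => by
    simp only [hA]
    rw [mul_pow, Real.sq_sqrt (by positivity)]
  set Z : ℝ := ((Finset.univ.filter fun k : Fin N → Fin N => Function.Injective k).card : ℝ) with hZ
  have hZ0 : 0 < Z := by
    rw [hZ]
    exact_mod_cast Finset.card_pos.2 ⟨id, by simp [Function.injective_id]⟩
  -- Uniform weights on the injective labellings, here the permutations. Each of the two families
  -- carries half of the mass `δ`.
  set w : (Fin N → Fin N) → ℝ := fun k => if Function.Injective k then δ / 2 / Z else 0 with hw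
  have hwsum : ∑ k, w k = δ / 2 := by
    simp only [hw]
    rw [← Finset.sum_filter, Finset.sum_const, nsmul_eq_mul, ← hZ]
    field_simp
  have hslot : ∀ a, IsSlot (fun j x => A a j x * U x) w := fun a =>
    { measurable := fun j => (hAlip a j).continuous.measurable.mul hU
      memLp := fun j => hU2.bounded_mul (hAlip a j).continuous.measurable (hAb a j)
      lip := fun j v => (hl v).lipschitz_mul hU2 (hAlip a j) (hAb a j)
      disjoint := fun i j hij x => by
        have := arch_mul_arch hN0 (G x - (a : ℕ) / (2 * N)) hij
        simp only [sub_sub] at this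
        simp only [hA]
        linear_combination (√(2 * N) * U x * (√(2 * N) * U x)) * this
      nonneg := fun k => by
        simp only [hw]; split_ifs <;> positivity
      symm := fun σ k => by
        simp only [hw]
        have : Function.Injective (fun i => k (σ i)) ↔ Function.Injective k :=
          Equiv.injective_comp σ k
        simp only [this]
      inj := fun k hk => by
        by_contra h
        exact hk (by simp [hw, h]) }
  refine ⟨fun a j x => A a j x * U x, w, hslot, ?_, ?_, hwsum, ?_⟩
  · intro a k _ i
    simp only [mul_pow]
    have hcont : Continuous fun s => arch N (s - ((a : ℕ) / (2 * N) + ((k i : Fin N) : ℕ) / N)) :=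
      (continuous_arch hN0).comp (continuous_id.sub continuous_const)
    have h2 := hunif (fun s => ENNReal.ofReal (2 * N *
      arch N (s - ((a : ℕ) / (2 * N) + ((k i : Fin N) : ℕ) / N)) ^ 2))
      ((hcont.pow 2).const_mul _ |>.measurable.ennreal_ofReal)
    calc ∫⁻ y, ENNReal.ofReal (A a (k i) y ^ 2 * U y ^ 2) = _ := by
          refine lintegral_congr fun y => ?_
          rw [ENNReal.ofReal_mul (sq_nonneg _), hsq]
      _ = _ := h2
      _ = ENNReal.ofReal (∫ s in Set.Ioc (0 : ℝ) 1, 2 * N *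
          arch N (s - ((a : ℕ) / (2 * N) + ((k i : Fin N) : ℕ) / N)) ^ 2) := by
          rw [ofReal_integral_eq_lintegral_ofReal]
          · exact (((hcont.pow 2).const_mul _).integrableOn_Icc (a := (0 : ℝ)) (b := 1)).mono_set
              Set.Ioc_subset_Icc_self
          · exact Eventually.of_forall fun s => by positivity
      _ = 1 := by
          rw [← intervalIntegral.integral_of_le zero_le_one, intervalIntegral.integral_const_mul,
            integral_arch_sq hN0, mul_one_div_cancel (by positivity), ENNReal.ofReal_one]
  · intro a j x
    rw [mul_pow, hsq]
    have := abs_arch_le_one (N := N) (G x - ((a : ℕ) / (2 * N) + (j : ℕ) / N))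
    have h3 := (sq_le_one_iff_abs_le_one _).2 this
    have h4 : 2 * (N : ℝ) * arch N (G x - ((a : ℕ) / (2 * N) + (j : ℕ) / N)) ^ 2 ≤ 2 * N :=
      mul_le_of_le_one_right (by positivity) h3
    exact mul_le_mul_of_nonneg_right h4 (sq_nonneg _)
  · intro x
    -- The weights are invariant under cyclic shifts of the labels; averaging over all shifts shows
    -- that the label of the first particle is uniform.
    have huni : ∀ f : Fin N → ℝ, ∑ k, w k * f (k 0) = δ / 2 / N * ∑ j, f j := by
      intro f
      have hshift : ∀ c : Fin N, ∑ k, w k * f (k 0) = ∑ k, w k * f (k 0 + c) := by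
        intro c
        rw [← (Equiv.arrowCongr (Equiv.refl (Fin N)) (Equiv.addRight c)).sum_comp]
        refine Finset.sum_congr rfl fun k _ => ?_
        have e : (Equiv.arrowCongr (Equiv.refl (Fin N)) (Equiv.addRight c)) k
            = fun i => k i + c := by
          ext i; simp [Equiv.arrowCongr]
        have hinj : Function.Injective (fun i => k i + c) ↔ Function.Injective k :=
          Function.Injective.of_comp_iff (add_left_injective c) k
        simp only [e, hw, hinj]
      have hs : (N : ℝ) * ∑ k, w k * f (k 0) = δ / 2 * ∑ j, f j := by
        calc (N : ℝ) * ∑ k, w k * f (k 0) = ∑ c : Fin N, ∑ k, w k * f (k 0 + c) := by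
              simp_rw [← hshift]; simp
          _ = ∑ k, w k * ∑ c : Fin N, f (k 0 + c) := by
              rw [Finset.sum_comm]; simp_rw [Finset.mul_sum]
          _ = ∑ k, w k * ∑ j, f j := by
              refine Finset.sum_congr rfl fun k _ => ?_
              exact congrArg _ (Equiv.sum_comp (Equiv.addLeft (k 0)) f)
          _ = _ := by rw [← Finset.sum_mul, hwsum]
      field_simp
      linarith
    have hfin : ∑ a : Fin 2, ∑ j : Fin N, (A a j x * U x) ^ 2 = 2 * N * U x ^ 2 := by
      have h2 := sum_sum_arch_sq hN0 (G x)
      simp only [sub_sub] at h2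
      simp_rw [mul_pow, hsq]
      simp_rw [mul_right_comm (2 * (N : ℝ)) _ (U x ^ 2), ← Finset.mul_sum, h2, mul_one]
    rw [Finset.sum_congr rfl fun a _ => huni fun j => (A a j x * U x) ^ 2, ← Finset.mul_sum, hfin]
    field_simp

/-- Since `slot_sq` has no cross terms, the squared state is dominated pointwise by a multiple of
the product density of `U²`. -/
theorem IsSlot.lintegral_coulomb_le {n M : ℕ} {φ : Fin M → R3 → ℝ}
    {w : (Fin (n + 1) → Fin M) → ℝ} (h : IsSlot φ w) {U : R3 → ℝ} (hU : Measurable U) {b : ℝ}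
    (hb : 0 ≤ b) (hφ : ∀ j x, φ j x ^ 2 ≤ b * U x ^ 2) :
    ∫⁻ x, coulomb x * ENNReal.ofReal (slot φ w x ^ 2)
      ≤ ENNReal.ofReal ((∑ k, w k) * b ^ (n + 1))
        * ∫⁻ x : Config (n + 1), coulomb x * ∏ i, ENNReal.ofReal (U (x i) ^ 2) := by
  have hm : Measurable fun x : Config (n + 1) =>
      coulomb x * ∏ i, ENNReal.ofReal (U (x i) ^ 2) :=
    measurable_coulomb.mul (measurable_config_prod fun _ => (hU.pow_const 2).ennreal_ofReal)
  rw [← lintegral_const_mul _ hm]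
  refine lintegral_mono fun x => ?_
  have hs : slot φ w x ^ 2 ≤ ((∑ k, w k) * b ^ (n + 1)) * ∏ i, U (x i) ^ 2 := by
    rw [h.slot_sq, Finset.sum_mul, Finset.sum_mul]
    refine Finset.sum_le_sum fun k _ => ?_
    rw [mul_assoc]
    refine mul_le_mul_of_nonneg_left ?_ (h.nonneg k)
    refine (Finset.prod_le_prod (fun _ _ => sq_nonneg _) fun i _ => hφ (k i) (x i)).trans_eq ?_
    rw [Finset.prod_mul_distrib, Finset.prod_const, Finset.card_univ, Fintype.card_fin]
  calc coulomb x * ENNReal.ofReal (slot φ w x ^ 2)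
      ≤ coulomb x * ENNReal.ofReal (((∑ k, w k) * b ^ (n + 1)) * ∏ i, U (x i) ^ 2) := by
        gcongr
    _ = _ := by
        rw [ENNReal.ofReal_mul (mul_nonneg (Finset.sum_nonneg fun k _ => h.nonneg k)
          (pow_nonneg hb _)), ENNReal.ofReal_prod_of_nonneg fun _ _ => sq_nonneg _]
        ring

/-! ### Discretization of transport plans -/

/-- Up to a small mass, a finite measure is carried by finitely many disjoint compact sets of small
diameter. -/
theorem exists_disjoint_compacts (μ : Measure R3) [IsFiniteMeasure μ] {d : ℝ} (hd : 0 < d)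
    {κ : ℝ≥0∞} (hκ : κ ≠ 0) : ∃ (M : ℕ) (K : Fin M → Set R3), (∀ j, IsCompact (K j)) ∧
      (∀ i j, i ≠ j → Disjoint (K i) (K j)) ∧ (∀ j, ∀ x ∈ K j, ∀ y ∈ K j, dist x y ≤ d) ∧
      μ (⋃ j, K j)ᶜ ≤ κ := by
  set B : ℕ → Set R3 := fun i => Metric.ball (TopologicalSpace.denseSeq R3 i) (d / 2) with hB
  set D : ℕ → Set R3 := disjointed B with hD
  have hDm : ∀ i, MeasurableSet (D i) := fun i =>
    MeasurableSet.disjointed (fun i => Metric.isOpen_ball.measurableSet) i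
  have hDdisj : Pairwise (Function.onFun Disjoint D) := disjoint_disjointed B
  have hDu : ⋃ i, D i = Set.univ := by
    rw [hD, iUnion_disjointed, Set.eq_univ_iff_forall]
    intro x
    obtain ⟨i, hi⟩ := (TopologicalSpace.denseRange_denseSeq R3).exists_dist_lt x (half_pos hd)
    exact Set.mem_iUnion.2 ⟨i, hi⟩
  have hκ2 : κ / 2 ≠ 0 := (ENNReal.half_pos hκ).ne'
  obtain ⟨M, hM⟩ : ∃ M : ℕ, μ (⋃ i ∈ Finset.range M, D i)ᶜ ≤ κ / 2 := by
    have hanti : Antitone fun M : ℕ => (⋃ i ∈ Finset.range M, D i)ᶜ := by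
      intro a b hab
      exact Set.compl_subset_compl.2 (Set.biUnion_subset_biUnion_left
        (by intro i hi; simp only [Finset.mem_coe, Finset.mem_range] at hi ⊢; omega))
    have h := tendsto_measure_iInter_atTop (μ := μ)
      (fun M => ((Finset.range M).measurableSet_biUnion fun i _ => hDm i).compl.nullMeasurableSet)
      hanti ⟨0, measure_ne_top _ _⟩
    have he : ⋂ M : ℕ, (⋃ i ∈ Finset.range M, D i)ᶜ = ∅ := by
      rw [← Set.compl_iUnion, Set.compl_empty_iff, Set.eq_univ_iff_forall]
      intro x
      obtain ⟨i, hi⟩ := Set.mem_iUnion.1 (hDu ▸ Set.mem_univ x)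
      exact Set.mem_iUnion.2 ⟨i + 1, Set.mem_biUnion (by simp) hi⟩
    rw [he, measure_empty] at h
    exact (h.eventually (ge_mem_nhds (pos_iff_ne_zero.2 hκ2))).exists
  have hη : κ / 2 / (M + 1 : ℕ) ≠ 0 := (ENNReal.div_pos hκ2 (by simp)).ne'
  choose K hKD hKc hKm using fun i => (hDm i).exists_isCompact_sdiff_lt (measure_ne_top μ _) hη
  refine ⟨M, fun j => K j, fun j => hKc j, fun i j hij => ?_, fun j x hx y hy => ?_, ?_⟩
  · exact (hDdisj fun h => hij (Fin.ext h)).mono (hKD _) (hKD _)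
  · have h1 : x ∈ B j := disjointed_subset B j (hKD _ hx)
    have h2 : y ∈ B j := disjointed_subset B j (hKD _ hy)
    simp only [hB, Metric.mem_ball] at h1 h2
    have := dist_triangle_right x y (TopologicalSpace.denseSeq R3 j)
    linarith
  · have hsub : (⋃ j : Fin M, K j)ᶜ ⊆ (⋃ i ∈ Finset.range M, D i)ᶜ ∪
        ⋃ i ∈ Finset.range M, D i \ K i := by
      intro x hx
      by_cases h : x ∈ ⋃ i ∈ Finset.range M, D i
      · right
        simp only [Set.mem_iUnion, Finset.mem_range, exists_prop] at h ⊢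
        obtain ⟨i, hi, hxi⟩ := h
        exact ⟨i, hi, hxi, fun hk => hx (Set.mem_iUnion.2 ⟨⟨i, hi⟩, hk⟩)⟩
      · exact Or.inl h
    calc μ (⋃ j : Fin M, K j)ᶜ ≤ κ / 2 + ∑ i ∈ Finset.range M, κ / 2 / (M + 1 : ℕ) := by
          refine (measure_mono hsub).trans ((measure_union_le _ _).trans (add_le_add hM ?_))
          exact (measure_biUnion_finset_le _ _).trans (Finset.sum_le_sum fun i _ => (hKm i).le)
      _ ≤ κ / 2 + κ / 2 := by
          gcongr
          rw [Finset.sum_const, Finset.card_range, nsmul_eq_mul]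
          calc (M : ℝ≥0∞) * (κ / 2 / (M + 1 : ℕ)) ≤ (M + 1 : ℕ) * (κ / 2 / (M + 1 : ℕ)) := by
                gcongr; simp
            _ ≤ κ / 2 := ENNReal.mul_div_le
      _ = κ := ENNReal.add_halves κ

/-- Lipschitz bumps with disjoint supports of small diameter, equal to `1` on most of the mass. -/
theorem exists_bumps (μ : Measure R3) [IsFiniteMeasure μ] {d : ℝ} (hd : 0 < d)
    {κ : ℝ≥0∞} (hκ : κ ≠ 0) : ∃ (M : ℕ) (K : Fin M → Set R3) (χ : Fin M → R3 → ℝ) (L : NNReal),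
      (∀ j, MeasurableSet (K j)) ∧ (∀ j, LipschitzWith L (χ j)) ∧ (∀ j x, 0 ≤ χ j x) ∧
      (∀ j x, χ j x ≤ 1) ∧ (∀ j, ∀ x ∈ K j, χ j x = 1) ∧
      (∀ i j, i ≠ j → ∀ x, χ i x * χ j x = 0) ∧
      (∀ j x y, χ j x ≠ 0 → χ j y ≠ 0 → dist x y ≤ d) ∧ μ (⋃ j, K j)ᶜ ≤ κ := by
  -- A third of `d` goes to the diameter of the compact sets and at most a third to each of two
  -- thickenings, whose radius `τ` also keeps them disjoint.
  obtain ⟨M, K, hKc, hKd, hKdiam, hKμ⟩ := exists_disjoint_compacts μ (d := d / 3) (by positivity) hκ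
  obtain ⟨τ, hτ0, hτd, hτ⟩ : ∃ τ : ℝ, 0 < τ ∧ τ ≤ d / 3 ∧ ∀ i j, i ≠ j →
      Disjoint (Metric.thickening τ (K i)) (Metric.thickening τ (K j)) := by
    have hev : ∀ᶠ τ : ℝ in 𝓝[>] 0, ∀ i j, i ≠ j →
        Disjoint (Metric.thickening τ (K i)) (Metric.thickening τ (K j)) := by
      refine eventually_all.2 fun i => eventually_all.2 fun j => ?_
      by_cases hij : i = j
      · exact Eventually.of_forall fun _ h => absurd hij h
      obtain ⟨r, hr, hdis⟩ := (hKd i j hij).exists_thickenings (hKc i) (hKc j).isClosed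
      filter_upwards [Ioo_mem_nhdsGT hr] with τ hτ _
      exact hdis.mono (Metric.thickening_mono hτ.2.le _) (Metric.thickening_mono hτ.2.le _)
    obtain ⟨τ, h1, h2⟩ := (hev.and (Ioc_mem_nhdsGT (show 0 < d / 3 by positivity))).exists
    exact ⟨τ, h2.1, h2.2, h1⟩
  have hsupp : ∀ j x, (thickenedIndicator hτ0 (K j) x : ℝ) ≠ 0 → x ∈ Metric.thickening τ (K j) := by
    intro j x hx
    by_contra h
    exact hx (by rw [thickenedIndicator_zero hτ0 _ h]; rfl)
  refine ⟨M, K, fun j x => (thickenedIndicator hτ0 (K j) x : ℝ), τ.toNNReal⁻¹,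
    fun j => (hKc j).isClosed.measurableSet, fun j => ?_, fun j x => NNReal.coe_nonneg _,
    fun j x => ?_, fun j x hx => ?_, fun i j hij x => ?_, fun j x y hx hy => ?_, hKμ⟩
  · have := lipschitzWith_thickenedIndicator hτ0 (K j)
    exact LipschitzWith.of_dist_le_mul fun x y => this.dist_le_mul x y
  · exact_mod_cast thickenedIndicator_le_one hτ0 (K j) x
  · simp [thickenedIndicator_one hτ0 _ hx]
  · by_contra h
    exact Set.disjoint_left.1 (hτ i j hij) (hsupp i x (left_ne_zero_of_mul h))
      (hsupp j x (right_ne_zero_of_mul h))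
  · obtain ⟨p, hp, hxp⟩ := Metric.mem_thickening_iff.1 (hsupp j x hx)
    obtain ⟨q, hq, hyq⟩ := Metric.mem_thickening_iff.1 (hsupp j y hy)
    have h1 := hKdiam j p hp q hq
    have h2 := dist_triangle4 x p q y
    rw [dist_comm q y] at h2
    linarith

theorem coulomb_le_of_norm_sub_le {N : ℕ} {ε : ℝ} (hε : 0 < ε) {x y : Config N}
    (h : ∀ i j, i ≠ j → ‖y i - y j‖ ≤ (1 + ε) * ‖x i - x j‖) :
    coulomb x ≤ ENNReal.ofReal (1 + ε) * coulomb y := by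
  unfold coulomb
  simp_rw [Finset.mul_sum]
  refine Finset.sum_le_sum fun i _ => Finset.sum_le_sum fun j hj => ?_
  have hij := h i j (Finset.mem_Ioi.1 hj).ne
  have h1 : ‖y i - y j‖ₑ ≤ ENNReal.ofReal (1 + ε) * ‖x i - x j‖ₑ := by
    rw [← ofReal_norm, ← ofReal_norm, ← ENNReal.ofReal_mul (by linarith)]
    exact ENNReal.ofReal_le_ofReal hij
  have h0 : ENNReal.ofReal (1 + ε) ≠ 0 := by
    rw [Ne, ENNReal.ofReal_eq_zero, not_le]; linarith
  calc ‖x i - x j‖ₑ⁻¹ = ENNReal.ofReal (1 + ε) * (ENNReal.ofReal (1 + ε) * ‖x i - x j‖ₑ)⁻¹ := by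
        rw [ENNReal.mul_inv (Or.inl h0) (Or.inl ENNReal.ofReal_ne_top), ← mul_assoc,
          ENNReal.mul_inv_cancel h0 ENNReal.ofReal_ne_top, one_mul]
    _ ≤ _ := by gcongr

/-- Symmetry is given on boxes only; a condition on one particle is a box with all other sides full,
and the swap of `i` and `0` exchanges two such boxes. -/
theorem IsSymmProb.measure_eval_mem {n : ℕ} {γ : Measure (Config (n + 1))} (h : IsSymmProb γ)
    (i : Fin (n + 1)) {A : Set R3} (hA : MeasurableSet A) :
    γ {x | x i ∈ A} = γ {x | x 0 ∈ A} := by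
  classical
  have e : ∀ j : Fin (n + 1), {x : Config (n + 1) | x j ∈ A}
      = Set.univ.pi (Function.update (fun _ => Set.univ) j A) := by
    intro j
    ext x
    simp only [Set.mem_ofPred_eq, Set.mem_univ_pi]
    constructor
    · intro hx l
      by_cases hl : l = j
      · subst hl; simpa using hx
      · simp [Function.update_of_ne hl]
    · intro hx; simpa using hx j
  rw [e i, e 0, h.symm (Equiv.swap i 0)]
  · congr 2
    ext l x
    by_cases hl : l = 0
    · subst hl; simp
    · have : Equiv.swap i 0 l ≠ i := fun h' => hl (by
        have := congrArg (Equiv.swap i 0) h'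
        simpa using this)
      simp [Function.update_of_ne hl, Function.update_of_ne this]
  · intro j
    by_cases hj : j = i
    · subst hj; simpa using hA
    · simp [Function.update_of_ne hj]

theorem le_coulomb_of_dist_lt {N : ℕ} {x : Config N} {i j : Fin N} (hij : i ≠ j) {β : ℝ}
    (h : ‖x i - x j‖ < β) : (ENNReal.ofReal β)⁻¹ ≤ coulomb x := by
  have key : ∀ a b : Fin N, a < b → ‖x a - x b‖ < β → (ENNReal.ofReal β)⁻¹ ≤ coulomb x := by
    intro a b hab hlt
    calc (ENNReal.ofReal β)⁻¹ ≤ ‖x a - x b‖ₑ⁻¹ := by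
          rw [← ofReal_norm]
          exact ENNReal.inv_le_inv.2 (ENNReal.ofReal_le_ofReal hlt.le)
      _ ≤ ∑ l ∈ Finset.Ioi a, ‖x a - x l‖ₑ⁻¹ :=
          Finset.single_le_sum (f := fun l => ‖x a - x l‖ₑ⁻¹) (fun _ _ => zero_le)
            (Finset.mem_Ioi.2 hab)
      _ ≤ coulomb x := Finset.single_le_sum
          (f := fun a => ∑ l ∈ Finset.Ioi a, ‖x a - x l‖ₑ⁻¹) (fun _ _ => zero_le)
            (Finset.mem_univ a)
  rcases lt_or_gt_of_ne hij with h' | h'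
  · exact key i j h' h
  · exact key j i h' (by rwa [norm_sub_rev])

section Bulk

variable {n M : ℕ}

/-- The boxes of the labelling `k` are separated so that distances of particles in them are
nearly constant. -/
def WellSeparated (ε : ℝ) (χ : Fin M → R3 → ℝ) (k : Fin (n + 1) → Fin M) : Prop :=
  Function.Injective k ∧ ∀ x y : Config (n + 1), (∀ i, χ (k i) (x i) ≠ 0) →
    (∀ i, χ (k i) (y i) ≠ 0) → ∀ i j, i ≠ j → ‖y i - y j‖ ≤ (1 + ε) * ‖x i - x j‖

theorem WellSeparated.comp_perm {ε : ℝ} {χ : Fin M → R3 → ℝ} {k : Fin (n + 1) → Fin M}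
    (h : WellSeparated ε χ k) (σ : Equiv.Perm (Fin (n + 1))) :
    WellSeparated ε χ fun i => k (σ i) := by
  refine ⟨h.1.comp σ.injective, fun x y hx hy i j hij => ?_⟩
  have := h.2 (fun i => x (σ.symm i)) (fun i => y (σ.symm i))
    (fun i => by simpa using hx (σ.symm i)) (fun i => by simpa using hy (σ.symm i)) (σ i) (σ j)
    (σ.injective.ne hij)
  simpa using this

theorem wellSeparated_comp_perm_iff {ε : ℝ} {χ : Fin M → R3 → ℝ} {k : Fin (n + 1) → Fin M}
    (σ : Equiv.Perm (Fin (n + 1))) :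
    WellSeparated ε χ (fun i => k (σ i)) ↔ WellSeparated ε χ k :=
  ⟨fun h => by simpa using h.comp_perm σ.symm, fun h => h.comp_perm σ⟩

/-- Moving points within their boxes changes a mutual distance by at most `2 d`, and `hβ` says `2 d
≤ ε (β - 2 d)`. So one configuration with gaps at least `β` controls all the others. -/
theorem wellSeparated_of_dist_ge {ε d β : ℝ} (hε : 0 < ε) (hdβ : d < β)
    (hβ : 2 * d * (1 + ε) ≤ ε * β) {χ : Fin M → R3 → ℝ}
    (hχ : ∀ j x y, χ j x ≠ 0 → χ j y ≠ 0 → dist x y ≤ d) {k : Fin (n + 1) → Fin M}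
    {y : Config (n + 1)} (hy : ∀ i, χ (k i) (y i) ≠ 0)
    (hsep : ∀ i j, i ≠ j → β ≤ ‖y i - y j‖) : WellSeparated ε χ k := by
  refine ⟨fun i j hij => ?_, fun x z hx hz i j hij => ?_⟩
  · by_contra hne
    have h1 := hχ (k i) (y i) (y j) (hy i) (hij ▸ hy j)
    rw [dist_eq_norm] at h1
    linarith [hsep i j hne]
  · have h1 : ∀ p q : Config (n + 1), (∀ i, χ (k i) (p i) ≠ 0) → (∀ i, χ (k i) (q i) ≠ 0) →
        ‖p i - p j‖ ≤ ‖q i - q j‖ + 2 * d := by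
      intro p q hp hq
      have hi := hχ (k i) _ _ (hp i) (hq i)
      have hj := hχ (k j) _ _ (hq j) (hp j)
      have h4 := dist_triangle4 (p i) (q i) (q j) (p j)
      rw [dist_eq_norm (p i) (p j), dist_eq_norm (q i) (q j)] at h4
      linarith
    have h2 := h1 z x hz hx
    have h3 := h1 y x hy hx
    have h4 := hsep i j hij
    nlinarith

/-- Discretization of a transport plan by an antisymmetric superposition of localized orbitals. -/
theorem exists_bulk_slot {u : R3 → ℝ} (hu : Measurable u) (hu2 : MemLp u 2 volume)
    (hl : ∀ v, LipTranslates v u) {γ : Measure (Config (n + 1))} (hγ : IsSymmProb γ)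
    (hmarg : ∀ A, MeasurableSet A →
      (n + 1 : ℕ) * γ {x | x 0 ∈ A} = ∫⁻ x in A, ENNReal.ofReal (u x ^ 2))
    (hcost : ∫⁻ x, coulomb x ∂γ ≠ ⊤) {ε : ℝ} (hε : 0 < ε) (hε1 : ε < 1) :
    ∃ (M : ℕ) (φ : Fin M → R3 → ℝ) (w : (Fin (n + 1) → Fin M) → ℝ) (η : R3 → ℝ) (L : NNReal),
      IsSlot φ w ∧ IsSlot.Normalized φ w ∧ LipschitzWith L η ∧ (∀ x, |η x| ≤ 1) ∧
      (∀ x, (n + 1 : ℕ) * ∑ k, w k * φ (k 0) x ^ 2 = (1 - η x ^ 2) * u x ^ 2) ∧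
      1 - ε ≤ ∑ k, w k ∧ ∑ k, w k < 1 ∧
      ∫⁻ x, coulomb x * ENNReal.ofReal (slot φ w x ^ 2)
        ≤ ENNReal.ofReal (1 + ε) * ∫⁻ x, coulomb x ∂γ := by
  classical
  have := hγ.prob
  have hN' : (0 : ℝ) < (n + 1 : ℕ) := by positivity
  set c₀ : ℝ := (∫⁻ x, coulomb x ∂γ).toReal with hc₀
  have hc₀0 : 0 ≤ c₀ := ENNReal.toReal_nonneg
  -- By Markov's inequality, under `γ` some pair is closer than `β` with probability at most `β c₀ ≤
  -- ε / 4`.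
  set β : ℝ := ε / (4 * (c₀ + 1)) with hβ
  have hβ0 : 0 < β := by positivity
  set d : ℝ := ε * β / 4 with hd
  have hd0 : 0 < d := by positivity
  have hdβ : d < β := by rw [hd]; nlinarith
  have hdε : 2 * d * (1 + ε) ≤ ε * β := by rw [hd]; nlinarith [mul_pos hε hβ0]
  set μ : Measure R3 := γ.map fun x => x 0 with hμ
  have : IsFiniteMeasure μ := Measure.isFiniteMeasure_map γ _
  have hμA : ∀ A, MeasurableSet A → μ A = γ {x | x 0 ∈ A} := fun A hA =>
    Measure.map_apply (measurable_pi_apply 0) hA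
  -- The union bound over the `n + 1` particles turns this into `ε / 4`.
  set κ : ℝ := ε / (4 * (n + 1 : ℕ)) with hκ
  have hκ0 : 0 < κ := by positivity
  obtain ⟨M, K, χ, L, hKm, hχL, hχ0, hχ1, hχK, hχd, hχdiam, hKμ⟩ :=
    exists_bumps μ hd0 (κ := ENNReal.ofReal κ) (by simpa using hκ0)
  have hχm : ∀ j, Measurable (χ j) := fun j => (hχL j).continuous.measurable
  have hKχ : ∀ j, ∀ x ∈ K j, χ j x ≠ 0 := fun j x hx => by simp [hχK j x hx]
  set B : (Fin (n + 1) → Fin M) → Set (Config (n + 1)) := fun k => Set.univ.pi fun i => K (k i) with hB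
  have hBm : ∀ k, MeasurableSet (B k) := fun k => .univ_pi fun i => hKm _
  have hBd : ∀ k l, k ≠ l → Disjoint (B k) (B l) := by
    intro k l hkl
    obtain ⟨i, hi⟩ := Function.ne_iff.1 hkl
    rw [Set.disjoint_left]
    intro x hx hx'
    exact mul_ne_zero (hKχ _ _ (hx i trivial)) (hKχ _ _ (hx' i trivial)) (hχd _ _ hi (x i))
  -- The factor `1 - ε / 2` keeps the leftover fraction of the density above `ε / 2` everywhere, so
  -- its square root `η` is Lipschitz; it also makes the total weight strictly less than one.
  set w : (Fin (n + 1) → Fin M) → ℝ := fun k =>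
    if WellSeparated ε χ k then (1 - ε / 2) * γ.real (B k) else 0 with hw
  have hw0 : ∀ k, 0 ≤ w k := fun k => by
    simp only [hw]
    split_ifs
    · exact mul_nonneg (by linarith) measureReal_nonneg
    · exact le_rfl
  have hwle : ∀ k, w k ≤ (1 - ε / 2) * γ.real (B k) := fun k => by
    simp only [hw]
    split_ifs
    · exact le_rfl
    · exact mul_nonneg (by linarith) measureReal_nonneg
  -- masses of the localized orbitals
  set I : Fin M → ℝ≥0∞ := fun j => ∫⁻ x, ENNReal.ofReal ((χ j x * u x) ^ 2) with hI
  have hφ2 : ∀ j, MemLp (fun x => χ j x * u x) 2 volume := fun j =>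
    hu2.bounded_mul (hχm j) (B := 1) fun x => by rw [abs_of_nonneg (hχ0 j x)]; exact hχ1 j x
  have hItop : ∀ j, I j ≠ ⊤ := fun j => by
    have := (hφ2 j).lintegral_enorm_sq_lt_top
    refine ne_of_eq_of_ne (lintegral_congr fun x => ?_) this.ne
    rw [Real.enorm_eq_ofReal_abs, ← ENNReal.ofReal_pow (abs_nonneg _), sq_abs]
  have hKI : ∀ i j, ((n + 1 : ℕ) : ℝ≥0∞) * γ {x | x i ∈ K j} ≤ I j := by
    intro i j
    rw [hγ.measure_eval_mem i (hKm j), hmarg _ (hKm j), ← lintegral_indicator (hKm j)]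
    refine lintegral_mono fun x => ?_
    by_cases hx : x ∈ K j
    · rw [Set.indicator_of_mem hx, hχK j x hx, one_mul]
    · rw [Set.indicator_of_notMem hx]; exact zero_le
  set m : Fin M → ℝ := fun j => (I j).toReal with hm
  have hm0 : ∀ j, 0 ≤ m j := fun j => ENNReal.toReal_nonneg
  have hKm' : ∀ i j, (n + 1 : ℕ) * γ.real {x | x i ∈ K j} ≤ m j := by
    intro i j
    have := ENNReal.toReal_mono (hItop j) (hKI i j)
    rwa [ENNReal.toReal_mul, ENNReal.toReal_natCast] at this
  have hBK : ∀ k i, B k ⊆ {x | x i ∈ K (k i)} := fun k i x hx => hx i trivial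
  have hwm : ∀ k, w k ≠ 0 → ∀ i, m (k i) ≠ 0 := by
    intro k hk i hmi
    have h1 := hKm' i (k i)
    rw [hmi] at h1
    have h2 : γ.real (B k) ≤ γ.real {x | x i ∈ K (k i)} := measureReal_mono (hBK k i)
    have h3 : γ.real {x : Config (n + 1) | x i ∈ K (k i)} ≤ 0 := by
      by_contra! h
      nlinarith
    have h4 := hwle k
    exact hk (le_antisymm (h4.trans (mul_nonpos_of_nonneg_of_nonpos (by linarith)
      (h2.trans h3))) (hw0 k))
  -- If `m j = 0` this orbital is zero by the convention for inverses; by `hwm` no labelling of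
  -- positive weight uses it.
  set φ : Fin M → R3 → ℝ := fun j x => (√(m j))⁻¹ * (χ j x * u x) with hφ
  have hφsq : ∀ j x, φ j x ^ 2 = (m j)⁻¹ * (χ j x ^ 2 * u x ^ 2) := fun j x => by
    simp only [hφ]
    rw [mul_pow, inv_pow, Real.sq_sqrt (hm0 j), mul_pow]
  have hslot : IsSlot φ w :=
    { measurable := fun j => ((hχm j).mul hu).const_mul _
      memLp := fun j => (hφ2 j).const_smul (√(m j))⁻¹
      lip := fun j v => ((hl v).lipschitz_mul hu2 (hχL j) (B := 1) fun x => by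
        rw [abs_of_nonneg (hχ0 j x)]; exact hχ1 j x).const_smul (√(m j))⁻¹
      disjoint := fun i j hij x => by
        simp only [hφ]
        linear_combination ((√(m i))⁻¹ * u x * ((√(m j))⁻¹ * u x)) * hχd i j hij x
      nonneg := hw0
      symm := fun σ k => by
        have : γ.real (B fun i => k (σ i)) = γ.real (B k) := by
          simp only [measureReal_def, hB]
          rw [hγ.symm σ (fun i => K (k i)) fun i => hKm _]
        simp only [hw]
        rw [this]
        exact if_congr (wellSeparated_comp_perm_iff σ) rfl rfl
      inj := fun k hk => by
        by_contra h
        exact hk (by simp only [hw]; rw [if_neg fun h' => h h'.1]) }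
  have hnorm : IsSlot.Normalized φ w := by
    intro k hk i
    have hmi := (hm0 (k i)).lt_of_ne' (hwm k hk i)
    have e : ∀ y, ENNReal.ofReal (φ (k i) y ^ 2)
        = ENNReal.ofReal (m (k i))⁻¹ * ENNReal.ofReal ((χ (k i) y * u y) ^ 2) := fun y => by
      rw [hφsq, ENNReal.ofReal_mul (inv_nonneg.2 hmi.le), mul_pow]
    have em : Measurable fun y => ENNReal.ofReal ((χ (k i) y * u y) ^ 2) :=
      (((hχm _).mul hu).pow_const 2).ennreal_ofReal
    simp_rw [e]
    rw [lintegral_const_mul _ em, ENNReal.ofReal_inv_of_pos hmi, hm, ENNReal.ofReal_toReal (hItop _)]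
    exact ENNReal.inv_mul_cancel (fun h => hmi.ne' (by simp [hm, h])) (hItop _)
  -- the one-body density
  set W : Fin M → ℝ := fun j => ∑ k : Fin (n + 1) → Fin M, if k 0 = j then w k else 0 with hW
  have hW0 : ∀ j, 0 ≤ W j := fun j => Finset.sum_nonneg fun k _ => by
    split_ifs
    · exact hw0 k
    · exact le_rfl
  have hWm : ∀ j, (n + 1 : ℕ) * W j ≤ (1 - ε / 2) * m j := by
    intro j
    have h1 : W j ≤ (1 - ε / 2) * γ.real {x | x 0 ∈ K j} := by
      calc W j = ∑ k ∈ Finset.univ.filter (fun k : Fin (n + 1) → Fin M => k 0 = j), w k := by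
            rw [Finset.sum_filter]
        _ ≤ ∑ k ∈ Finset.univ.filter (fun k : Fin (n + 1) → Fin M => k 0 = j),
            (1 - ε / 2) * γ.real (B k) := Finset.sum_le_sum fun k _ => hwle k
        _ = (1 - ε / 2) * γ.real (⋃ k ∈ Finset.univ.filter
            (fun k : Fin (n + 1) → Fin M => k 0 = j), B k) := by
            rw [measureReal_biUnion_finset (fun k _ l _ hkl => hBd k l hkl) fun k _ => hBm k,
              Finset.mul_sum]
        _ ≤ _ := by
            refine mul_le_mul_of_nonneg_left (measureReal_mono ?_) (by linarith)
            refine Set.iUnion₂_subset fun k hk => ?_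
            rw [Finset.mem_filter] at hk
            have := hBK k 0
            rwa [hk.2] at this
    have h2 := hKm' 0 j
    nlinarith
  -- The ratio of the mass placed on orbital `j` to the mass available there. It is at most `1 - ε /
  -- 2` because `χ j = 1` on `K j`, so `m j` dominates `n + 1` times the marginal mass of `K j`.
  set c : Fin M → ℝ := fun j => (n + 1 : ℕ) * W j / m j with hc
  have hc0 : ∀ j, 0 ≤ c j := fun j => div_nonneg (mul_nonneg hN'.le (hW0 j)) (hm0 j)
  have hc1 : ∀ j, c j ≤ 1 - ε / 2 := fun j => by
    rcases (hm0 j).eq_or_lt with h | h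
    · simp only [hc, ← h, div_zero]; linarith
    · simp only [hc]
      rw [div_le_iff₀ h]
      exact hWm j
  set q : R3 → ℝ := fun x => ∑ j, c j * χ j x ^ 2 with hq
  have hq0 : ∀ x, 0 ≤ q x := fun x => Finset.sum_nonneg fun j _ => mul_nonneg (hc0 j) (sq_nonneg _)
  have hq1 : ∀ x, q x ≤ 1 - ε / 2 := by
    intro x
    by_cases h : ∃ j, χ j x ≠ 0
    · obtain ⟨j, hj⟩ := h
      have : q x = c j * χ j x ^ 2 := by
        refine Finset.sum_eq_single j (fun i _ hi => ?_) (by simp)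
        have := hχd i j hi x
        rcases mul_eq_zero.1 this with h | h
        · simp [h]
        · exact absurd h hj
      rw [this]
      calc c j * χ j x ^ 2 ≤ c j * 1 :=
            mul_le_mul_of_nonneg_left (pow_le_one₀ (hχ0 j x) (hχ1 j x)) (hc0 j)
        _ ≤ _ := by rw [mul_one]; exact hc1 j
    · push Not at h
      have : q x = 0 := Finset.sum_eq_zero fun j _ => by simp [h j]
      rw [this]; linarith
  have hqlip : ∀ x y, |q x - q y| ≤ M * (2 * L) * dist x y := by
    intro x y
    have h1 : ∀ j, |c j * χ j x ^ 2 - c j * χ j y ^ 2| ≤ 2 * L * dist x y := by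
      intro j
      have h2 := (hχL j).dist_le_mul x y
      rw [Real.dist_eq] at h2
      have h3 : |χ j x + χ j y| ≤ 2 := by
        rw [abs_of_nonneg (add_nonneg (hχ0 j x) (hχ0 j y))]; linarith [hχ1 j x, hχ1 j y]
      have h4 : |c j| ≤ 1 := by rw [abs_of_nonneg (hc0 j)]; linarith [hc1 j]
      calc |c j * χ j x ^ 2 - c j * χ j y ^ 2|
          = |c j| * (|χ j x + χ j y| * |χ j x - χ j y|) := by
            rw [← abs_mul, ← abs_mul]; congr 1; ring
        _ ≤ 1 * (2 * (L * dist x y)) := by gcongr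
        _ = _ := by ring
    calc |q x - q y| = |∑ j, (c j * χ j x ^ 2 - c j * χ j y ^ 2)| := by
          rw [Finset.sum_sub_distrib]
      _ ≤ ∑ j, |c j * χ j x ^ 2 - c j * χ j y ^ 2| := Finset.abs_sum_le_sum_abs _ _
      _ ≤ ∑ j : Fin M, 2 * L * dist x y := Finset.sum_le_sum fun j _ => h1 j
      _ = _ := by simp; ring
  set η : R3 → ℝ := fun x => √(1 - q x) with hη
  have hηsq : ∀ x, η x ^ 2 = 1 - q x := fun x => Real.sq_sqrt (by linarith [hq1 x])
  set s : ℝ := √(ε / 2) with hs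
  have hs0 : 0 < s := Real.sqrt_pos.2 (by linarith)
  have hηs : ∀ x, s ≤ η x := fun x => Real.sqrt_le_sqrt (by linarith [hq1 x])
  have hηlip : LipschitzWith (Real.toNNReal (M * (2 * L) / (2 * s))) η :=
    LipschitzWith.of_dist_le_mul fun x y => by
      rw [Real.coe_toNNReal _ (by positivity), Real.dist_eq, div_mul_eq_mul_div,
        le_div_iff₀ (by positivity)]
      have h1 : |η x - η y| * (η x + η y) = |q x - q y| := by
        have h2 : 0 ≤ η x + η y := by linarith [hηs x, hηs y]
        rw [← abs_of_nonneg h2, ← abs_mul, abs_sub_comm (q x)]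
        congr 1
        linear_combination hηsq x - hηsq y
      have h3 : |η x - η y| * (2 * s) ≤ |η x - η y| * (η x + η y) :=
        mul_le_mul_of_nonneg_left (by linarith [hηs x, hηs y]) (abs_nonneg _)
      linarith [hqlip x y]
  -- the mass
  have hmass : 1 - ε / 2 ≤ ∑ k ∈ Finset.univ.filter (WellSeparated ε χ), γ.real (B k) := by
    have hcover : (Set.univ : Set (Config (n + 1))) ⊆
        (⋃ k ∈ Finset.univ.filter (WellSeparated ε χ), B k) ∪
          ((⋃ i : Fin (n + 1), {x | x i ∈ (⋃ j, K j)ᶜ}) ∪ {x | (ENNReal.ofReal β)⁻¹ ≤ coulomb x}) := by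
      intro y _
      by_cases h1 : ∀ i, y i ∈ ⋃ j, K j
      · by_cases h2 : ∀ i j, i ≠ j → β ≤ ‖y i - y j‖
        · left
          choose k hk using fun i => Set.mem_iUnion.1 (h1 i)
          refine Set.mem_biUnion (x := k) ?_ fun i _ => hk i
          exact Finset.mem_coe.2 (Finset.mem_filter.2 ⟨Finset.mem_univ _,
            wellSeparated_of_dist_ge hε hdβ hdε hχdiam (fun i => hKχ _ _ (hk i)) h2⟩)
        · right; right
          push Not at h2
          obtain ⟨i, j, hij, hlt⟩ := h2
          exact le_coulomb_of_dist_lt hij hlt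
      · right; left
        push Not at h1
        obtain ⟨i, hi⟩ := h1
        exact Set.mem_iUnion.2 ⟨i, hi⟩
    have hKc : MeasurableSet (⋃ j, K j)ᶜ := (MeasurableSet.iUnion hKm).compl
    have h1 : γ.real (⋃ i : Fin (n + 1), {x : Config (n + 1) | x i ∈ (⋃ j, K j)ᶜ}) ≤ ε / 4 := by
      calc _ ≤ ∑ i : Fin (n + 1), γ.real {x : Config (n + 1) | x i ∈ (⋃ j, K j)ᶜ} :=
            measureReal_iUnion_fintype_le _
        _ ≤ ∑ i : Fin (n + 1), κ := by
            refine Finset.sum_le_sum fun i _ => ?_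
            rw [measureReal_def, hγ.measure_eval_mem i hKc, ← hμA _ hKc]
            exact ENNReal.toReal_le_of_le_ofReal hκ0.le hKμ
        _ = ε / 4 := by
            simp only [Finset.sum_const, Finset.card_univ, Fintype.card_fin, nsmul_eq_mul, hκ]
            field_simp
    have h2 : γ.real {x : Config (n + 1) | (ENNReal.ofReal β)⁻¹ ≤ coulomb x} ≤ ε / 4 := by
      have hmk := mul_meas_ge_le_lintegral (μ := γ) (measurable_coulomb (N := n + 1))
        (ENNReal.ofReal β)⁻¹
      have h3 : γ {x : Config (n + 1) | (ENNReal.ofReal β)⁻¹ ≤ coulomb x} ≤ ENNReal.ofReal (β * c₀) := by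
        rw [ENNReal.ofReal_mul hβ0.le, hc₀, ENNReal.ofReal_toReal hcost]
        rw [mul_comm, ← div_eq_mul_inv, ENNReal.div_le_iff (by simpa using hβ0)
          ENNReal.ofReal_ne_top] at hmk
        rwa [mul_comm]
      refine (ENNReal.toReal_le_of_le_ofReal (by positivity) h3).trans ?_
      rw [hβ, div_mul_eq_mul_div, div_le_div_iff₀ (by positivity) (by norm_num)]
      nlinarith
    have h3 := measureReal_mono (μ := γ) hcover
    rw [probReal_univ] at h3
    have h4 := h3.trans (measureReal_union_le _ _)
    have h5 := measureReal_union_le (μ := γ) (⋃ i : Fin (n + 1), {x : Config (n + 1) | x i ∈ (⋃ j, K j)ᶜ})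
      {x | (ENNReal.ofReal β)⁻¹ ≤ coulomb x}
    rw [measureReal_biUnion_finset (fun k _ l _ hkl => hBd k l hkl) fun k _ => hBm k] at h4
    linarith
  have hwsum : ∑ k, w k
      = (1 - ε / 2) * ∑ k ∈ Finset.univ.filter (WellSeparated ε χ), γ.real (B k) := by
    rw [Finset.mul_sum, Finset.sum_filter]
  refine ⟨M, φ, w, η, _, hslot, hnorm, hηlip, fun x => ?_, fun x => ?_, ?_, ?_, ?_⟩
  · rw [abs_of_nonneg (Real.sqrt_nonneg _)]
    exact Real.sqrt_le_one.2 (by linarith [hq0 x])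
  · have h1 : ∑ k, w k * φ (k 0) x ^ 2 = ∑ j, W j * φ j x ^ 2 := by
      simp only [hW]
      simp_rw [Finset.sum_mul]
      rw [Finset.sum_comm]
      refine Finset.sum_congr rfl fun k _ => ?_
      simp
    rw [h1, hηsq, sub_sub_cancel, hq, Finset.mul_sum, Finset.sum_mul]
    refine Finset.sum_congr rfl fun j _ => ?_
    rw [hφsq]
    simp only [hc]
    ring
  · rw [hwsum]; nlinarith
  · have h1 : ∑ k ∈ Finset.univ.filter (WellSeparated ε χ), γ.real (B k) ≤ 1 := by
      rw [← measureReal_biUnion_finset (fun k _ l _ hkl => hBd k l hkl) fun k _ => hBm k]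
      exact measureReal_le_one
    rw [hwsum]; nlinarith
  · have hPm : ∀ k : Fin (n + 1) → Fin M, Measurable fun x : Config (n + 1) =>
        ∏ i, ENNReal.ofReal (φ (k i) (x i) ^ 2) := fun k =>
      measurable_config_prod fun i => hslot.measurable_ofReal_sq (k i)
    -- For `x` in the supports and any `y` in the box, the costs differ by at most the factor `1 +
    -- ε`. Since `w k ≤ γ (B k)`, the weighted cost at `x` is bounded by averaging over `y` with
    -- respect to `γ`; the squared orbitals then integrate to one.
    have hk : ∀ k, ∫⁻ x, coulomb x * (ENNReal.ofReal (w k) *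
        ∏ i, ENNReal.ofReal (φ (k i) (x i) ^ 2))
        ≤ ENNReal.ofReal (1 + ε) * ∫⁻ x in B k, coulomb x ∂γ := by
      intro k
      by_cases hk0 : w k = 0
      · simp [hk0]
      have hgood : WellSeparated ε χ k := by
        by_contra h
        exact hk0 (by simp only [hw]; rw [if_neg h])
      have hwγ : ENNReal.ofReal (w k) ≤ γ (B k) := by
        rw [← ofReal_measureReal]
        refine ENNReal.ofReal_le_ofReal ((hwle k).trans ?_)
        exact mul_le_of_le_one_left measureReal_nonneg (by linarith)
      have hpt : ∀ x, coulomb x * (ENNReal.ofReal (w k) *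
          ∏ i, ENNReal.ofReal (φ (k i) (x i) ^ 2))
          ≤ (ENNReal.ofReal (1 + ε) * ∫⁻ x in B k, coulomb x ∂γ) *
            ∏ i, ENNReal.ofReal (φ (k i) (x i) ^ 2) := by
        intro x
        by_cases hx : ∀ i, χ (k i) (x i) ≠ 0
        · rw [← mul_assoc]
          refine mul_le_mul_left ?_ _
          rw [← lintegral_const_mul _ measurable_coulomb]
          calc coulomb x * ENNReal.ofReal (w k) ≤ coulomb x * γ (B k) := by gcongr
            _ = ∫⁻ y in B k, coulomb x ∂γ := by rw [setLIntegral_const]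
            _ ≤ _ := setLIntegral_mono (measurable_coulomb.const_mul _) fun y hy =>
              coulomb_le_of_norm_sub_le hε (hgood.2 x y hx fun i => hKχ _ _ (hy i trivial))
        · push Not at hx
          obtain ⟨i, hi⟩ := hx
          have : ∏ i, ENNReal.ofReal (φ (k i) (x i) ^ 2) = 0 :=
            Finset.prod_eq_zero (Finset.mem_univ i) (by simp [hφ, hi])
          simp [this]
      refine (lintegral_mono hpt).trans_eq ?_
      rw [lintegral_const_mul _ (hPm k),
        lintegral_config_prod fun i => hslot.measurable_ofReal_sq (k i),
        Finset.prod_eq_one fun i _ => hnorm k hk0 i, mul_one]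
    have hsm : ∀ k : Fin (n + 1) → Fin M, Measurable fun x : Config (n + 1) => coulomb x *
        (ENNReal.ofReal (w k) * ∏ i, ENNReal.ofReal (φ (k i) (x i) ^ 2)) := fun k =>
      measurable_coulomb.mul ((hPm k).const_mul _)
    simp_rw [hslot.ofReal_slot_sq, Finset.mul_sum]
    rw [lintegral_finsetSum _ fun k _ => hsm k]
    refine (Finset.sum_le_sum fun k _ => hk k).trans ?_
    rw [← Finset.mul_sum, ← lintegral_biUnion_finset (fun k _ l _ hkl => hBd k l hkl)
      fun k _ => hBm k]
    gcongr
    exact Measure.restrict_le_self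

end Bulk

/-! ### Wavefunctions with prescribed density and nearly optimal interaction energy -/

section Recovery

variable {n : ℕ}

theorem HasWeakDeriv.congr_ae {X F : Type*} [NormedAddCommGroup X] [NormedSpace ℝ X]
    [MeasureSpace X] [NormedAddCommGroup F] [NormedSpace ℝ F] {v : X} {u u' g : X → F}
    (h : HasWeakDeriv v u g) (hu : u =ᵐ[volume] u') : HasWeakDeriv v u' g := fun φ hφ hc => by
  rw [← h φ hφ hc]
  refine integral_congr_ae ?_
  filter_upwards [hu] with x hx
  rw [hx]

/-- A Borel representative of `√ρ`. -/
theorem IsDensity.exists_measurable_sqrt {ρ : R3 → ℝ} (hρ : IsDensity n ρ) :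
    ∃ u : R3 → ℝ, Measurable u ∧ MemLp u 2 volume ∧ (∀ v, LipTranslates v u) ∧
      (∀ᵐ x, ρ x = u x ^ 2) ∧ ∫⁻ x, ENNReal.ofReal (u x ^ 2) = (n + 1 : ℕ) := by
  have h2 := hρ.sqrt_memH1.1
  have hm := h2.aestronglyMeasurable
  have hu2 : MemLp (hm.mk _) 2 volume := h2.ae_eq hm.ae_eq_mk
  have hsq : ∀ᵐ x, ρ x = hm.mk _ x ^ 2 := by
    filter_upwards [hm.ae_eq_mk, hρ.nonneg] with x hx h0
    rw [← hx, Real.sq_sqrt h0]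
  refine ⟨hm.mk _, hm.stronglyMeasurable_mk.measurable, hu2, fun v => ?_, hsq, ?_⟩
  · obtain ⟨g, hg, hd⟩ := hρ.sqrt_memH1.2 v
    exact (hd.congr_ae hm.ae_eq_mk).lipTranslates hu2 hg
  · rw [← ofReal_integral_eq_lintegral_ofReal hu2.integrable_sq
      (ae_of_all _ fun _ => sq_nonneg _), ← integral_congr_ae hsq, hρ.integral_eq,
      ENNReal.ofReal_natCast]

/-- The three slots occupy orthogonal real components of one wavefunction, so mass, density and
interaction energy are all additive. -/
theorem exists_wave_of_slots {ρ : R3 → ℝ} {M : Fin 3 → ℕ} {φ : ∀ a, Fin (M a) → R3 → ℝ}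
    {w : ∀ a, (Fin (n + 1) → Fin (M a)) → ℝ} (h : ∀ a, IsSlot (φ a) (w a))
    (hn : ∀ a, IsSlot.Normalized (φ a) (w a)) (h1 : ∑ a, ∑ k, w a k = 1)
    (hρ : ∀ᵐ x, ρ x = (n + 1 : ℕ) * ∑ a, ∑ k, w a k * φ a (k 0) x ^ 2) :
    ∃ Ψ : Wavefunction (n + 1), Admissible Ψ ∧ HasDensity Ψ ρ ∧
      interaction Ψ = ∑ a, ∫⁻ x, coulomb x * ENNReal.ofReal (slot (φ a) (w a) x ^ 2) := by
  have hm : ∀ a, Measurable fun x => ENNReal.ofReal (slot (φ a) (w a) x ^ 2) := fun a =>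
    ((h a).measurable_slot.pow_const 2).ennreal_ofReal
  refine ⟨spinWave fun a => slot (φ a) (w a), admissible_spinWave (fun a => (h a).memLp_slot)
    (fun a => (h a).lipTranslates_slot) (fun a => (h a).slot_comp_perm) ?_, ?_, ?_⟩
  · rw [lintegral_finsetSum _ fun a _ => hm a]
    simp_rw [fun a => (h a).lintegral_slot_sq (hn a)]
    simp_rw [← fun a => ENNReal.ofReal_sum_of_nonneg
      (s := Finset.univ) (f := w a) fun k _ => (h a).nonneg k]
    rw [← ENNReal.ofReal_sum_of_nonneg fun a _ => Finset.sum_nonneg fun k _ => (h a).nonneg k, h1,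
      ENNReal.ofReal_one]
  · filter_upwards [hρ] with x hx
    have hmc : ∀ a, Measurable fun y : Config n =>
        ENNReal.ofReal (slot (φ a) (w a) (Fin.cons x y) ^ 2) := fun a =>
      (hm a).comp (measurable_pi_iff.2 fun i => by
        refine Fin.cases ?_ (fun j => ?_) i
        · simp
        · simpa using measurable_pi_apply j)
    have hnn : ∀ a k, 0 ≤ w a k * φ a (k 0) x ^ 2 := fun a k =>
      mul_nonneg ((h a).nonneg k) (sq_nonneg _)
    unfold oneBodyDensity
    simp_rw [positionDensity_spinWave]
    rw [lintegral_finsetSum _ fun a _ => hmc a]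
    simp_rw [fun a => (h a).lintegral_slot_cons_sq (hn a) x]
    simp_rw [← fun a => ENNReal.ofReal_sum_of_nonneg
      (s := Finset.univ) (f := fun k => w a k * φ a (k 0) x ^ 2) fun k _ => hnn a k]
    rw [← ENNReal.ofReal_sum_of_nonneg fun a _ => Finset.sum_nonneg fun k _ => hnn a k, hx,
      ENNReal.ofReal_mul (Nat.cast_nonneg _), ENNReal.ofReal_natCast]
  · unfold interaction
    simp_rw [positionDensity_spinWave, Finset.mul_sum]
    exact lintegral_finsetSum _ fun a _ => measurable_coulomb.mul (hm a)

/-- Orbitals carrying a small fraction `δ` of the density `u²`, with small interaction energy. -/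
theorem exists_remainder_slots {u : R3 → ℝ} (hu : Measurable u) (hu2 : MemLp u 2 volume)
    (hl : ∀ v, LipTranslates v u) : ∃ C : ℝ, 0 ≤ C ∧ ∀ (η : R3 → ℝ) (L : NNReal) (δ : ℝ),
      LipschitzWith L η → (∀ x, |η x| ≤ 1) → 0 < δ →
      ∫⁻ x, ENNReal.ofReal ((η x * u x) ^ 2) = ENNReal.ofReal ((n + 1 : ℕ) * δ) →
      ∃ (φ : Fin 2 → Fin (n + 1) → R3 → ℝ) (w : (Fin (n + 1) → Fin (n + 1)) → ℝ),
        (∀ a, IsSlot (φ a) w) ∧ (∀ a, IsSlot.Normalized (φ a) w) ∧ ∑ k, w k = δ / 2 ∧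
        (∀ x, (n + 1 : ℕ) * ∑ a, ∑ k, w k * φ a (k 0) x ^ 2 = η x ^ 2 * u x ^ 2) ∧
        ∀ (a : Fin 2) (s : ℝ), 0 < s → ∫⁻ x, coulomb x * ENNReal.ofReal (slot (φ a) w x ^ 2)
          ≤ ENNReal.ofReal (C * (δ / s ^ 2 + s)) := by
  obtain ⟨K, hK⟩ := exists_potential_le hu hu2 hl
  have hN : (0 : ℝ) < (n + 1 : ℕ) := by positivity
  have hN1 : (1 : ℝ) ≤ (n + 1 : ℕ) := by exact_mod_cast Nat.succ_pos n
  -- `(2 N)^N` comes from bounding each squared orbital by `2 N U²`, and `N²` from the count of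
  -- pairs.
  set D : ℝ := (2 * (n + 1 : ℕ)) ^ (n + 1) * ((n + 1 : ℕ) : ℝ) ^ 2 with hD
  have hD0 : 0 ≤ D := by positivity
  refine ⟨D * (1 + K), by positivity, fun η L δ hη hη1 hδ hmass => ?_⟩
  have hNδ : 0 < (n + 1 : ℕ) * δ := by positivity
  set κ : ℝ := (√((n + 1 : ℕ) * δ))⁻¹ with hκ
  have hκsq : κ ^ 2 = ((n + 1 : ℕ) * δ)⁻¹ := by rw [hκ, inv_pow, Real.sq_sqrt hNδ.le]
  set U : R3 → ℝ := κ • fun x => η x * u x with hU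
  have hUsq : ∀ x, U x ^ 2 = ((n + 1 : ℕ) * δ)⁻¹ * (η x * u x) ^ 2 := fun x => by
    rw [← hκsq, ← mul_pow]; rfl
  have hηu : Measurable fun x => η x * u x := hη.continuous.measurable.mul hu
  have hUm : Measurable U := hηu.const_smul κ
  have hUm2 : Measurable fun x => ENNReal.ofReal (U x ^ 2) := (hUm.pow_const 2).ennreal_ofReal
  have hU2 : MemLp U 2 volume :=
    (hu2.bounded_mul hη.continuous.measurable (B := 1) hη1).const_smul κ
  have hUl : ∀ v, LipTranslates v U := fun v =>
    ((hl v).lipschitz_mul hu2 hη (B := 1) hη1).const_smul κ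
  have hU1 : ∫⁻ x, ENNReal.ofReal (U x ^ 2) = 1 := by
    have em : Measurable fun x => ENNReal.ofReal ((η x * u x) ^ 2) :=
      (hηu.pow_const 2).ennreal_ofReal
    simp_rw [hUsq, ENNReal.ofReal_mul (inv_nonneg.2 hNδ.le)]
    rw [lintegral_const_mul _ em, hmass, ← ENNReal.ofReal_mul (inv_nonneg.2 hNδ.le),
      inv_mul_cancel₀ hNδ.ne', ENNReal.ofReal_one]
  obtain ⟨φ, w, hs, hsn, hb, hw, hd⟩ := exists_arch_slots (n := n) hUm hU2 hUl hU1 hδ.le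
  refine ⟨φ, w, hs, hsn, hw, fun x => ?_, fun a s hs0 => ?_⟩
  · rw [hd, hUsq]
    field_simp
  · have hpot : ∀ c, ∫⁻ y, ‖y - c‖ₑ⁻¹ * ENNReal.ofReal (U y ^ 2)
        ≤ ENNReal.ofReal ((s ^ 2)⁻¹ + ((n + 1 : ℕ) * δ)⁻¹ * (K * s)) := by
      intro c
      refine (hK _ (ENNReal.ofReal ((n + 1 : ℕ) * δ)⁻¹) hUm2 (fun x => ?_) c s hs0).trans_eq ?_
      · rw [Real.enorm_eq_ofReal_abs, ← ENNReal.ofReal_pow (abs_nonneg _), sq_abs,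
          ← ENNReal.ofReal_mul (inv_nonneg.2 hNδ.le), hUsq, mul_pow]
        refine ENNReal.ofReal_le_ofReal (mul_le_mul_of_nonneg_left ?_ (inv_nonneg.2 hNδ.le))
        exact mul_le_of_le_one_left (sq_nonneg _) ((sq_le_one_iff_abs_le_one _).2 (hη1 x))
      · rw [hU1, mul_one, ← ENNReal.ofReal_inv_of_pos (by positivity),
          ← ENNReal.ofReal_coe_nnreal, ← ENNReal.ofReal_mul (by positivity),
          ← ENNReal.ofReal_mul (by positivity), ← ENNReal.ofReal_add (by positivity)
          (by positivity)]
    refine ((hs a).lintegral_coulomb_le hUm (by positivity) (hb a)).trans ?_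
    refine (mul_le_mul_right (lintegral_coulomb_mul_prod_le hUm2 hU1 hpot) _).trans ?_
    rw [← ENNReal.ofReal_natCast, ← ENNReal.ofReal_pow (by positivity),
      ← ENNReal.ofReal_mul (by positivity), ← ENNReal.ofReal_mul (by rw [hw]; positivity), hw]
    refine ENNReal.ofReal_le_ofReal ?_
    -- The weight `δ / 2` cancels the factor `1 / δ` in `U² ≤ u² / (N δ)`: the near part of the
    -- potential costs `O(s)` uniformly in `δ`, the far part `O(δ / s²)`.
    have e : δ / 2 * (2 * (n + 1 : ℕ)) ^ (n + 1) *
        (((n + 1 : ℕ) : ℝ) ^ 2 * ((s ^ 2)⁻¹ + ((n + 1 : ℕ) * δ)⁻¹ * (K * s)))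
        = D * ((δ / s ^ 2) / 2 + K * s / (2 * (n + 1 : ℕ))) := by
      rw [hD]; field_simp
    rw [e, mul_assoc D]
    refine mul_le_mul_of_nonneg_left ?_ hD0
    have h1 : 0 ≤ δ / s ^ 2 := by positivity
    have h2 : K * s / (2 * (n + 1 : ℕ)) ≤ K * s :=
      div_le_self (by positivity) (by linarith)
    have h3 : 0 ≤ K * (δ / s ^ 2) := by positivity
    nlinarith

/-- Completes a partial state to one with density exactly `ρ`: the missing mass is found by
subtraction and filled by the remainder orbitals, at a cost independent of the details of the bulk.
-/
theorem exists_wave_of_bulk {ρ u : R3 → ℝ} (hu : Measurable u) (hu2 : MemLp u 2 volume)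
    (hl : ∀ v, LipTranslates v u) (hρ : ∀ᵐ x, ρ x = u x ^ 2)
    (h1 : ∫⁻ x, ENNReal.ofReal (u x ^ 2) = (n + 1 : ℕ)) : ∃ C : ℝ, 0 ≤ C ∧
      ∀ (M : ℕ) (φ : Fin M → R3 → ℝ) (w : (Fin (n + 1) → Fin M) → ℝ) (η : R3 → ℝ) (L : NNReal)
        (s : ℝ), IsSlot φ w → IsSlot.Normalized φ w → LipschitzWith L η → (∀ x, |η x| ≤ 1) →
      (∀ x, (n + 1 : ℕ) * ∑ k, w k * φ (k 0) x ^ 2 = (1 - η x ^ 2) * u x ^ 2) →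
      ∑ k, w k < 1 → 0 < s →
      ∃ Ψ : Wavefunction (n + 1), Admissible Ψ ∧ HasDensity Ψ ρ ∧
        interaction Ψ ≤ (∫⁻ x, coulomb x * ENNReal.ofReal (slot φ w x ^ 2))
          + ENNReal.ofReal (C * ((1 - ∑ k, w k) / s ^ 2 + s)) := by
  obtain ⟨C, hC0, hC⟩ := exists_remainder_slots (n := n) hu hu2 hl
  refine ⟨2 * C, by positivity, fun M φ w η L s hs hn hη hη1 hd hw hs0 => ?_⟩
  have hN : (0 : ℝ) ≤ (n + 1 : ℕ) := by positivity
  have hηsq : ∀ x, η x ^ 2 ≤ 1 := fun x => (sq_le_one_iff_abs_le_one _).2 (hη1 x)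
  have hwnn : 0 ≤ ∑ k, w k := Finset.sum_nonneg fun k _ => hs.nonneg k
  have hmass : ∫⁻ x, ENNReal.ofReal ((η x * u x) ^ 2)
      = ENNReal.ofReal ((n + 1 : ℕ) * (1 - ∑ k, w k)) := by
    have hm2 : Measurable fun x => ENNReal.ofReal ((η x * u x) ^ 2) :=
      ((hη.continuous.measurable.mul hu).pow_const 2).ennreal_ofReal
    have hbulk : ∫⁻ x, ENNReal.ofReal ((1 - η x ^ 2) * u x ^ 2)
        = ENNReal.ofReal ((n + 1 : ℕ) * ∑ k, w k) := by
      have hm3 : ∀ k : Fin (n + 1) → Fin M, Measurable fun x =>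
          ENNReal.ofReal (w k) * ENNReal.ofReal (φ (k 0) x ^ 2) := fun k =>
        (hs.measurable_ofReal_sq (k 0)).const_mul _
      simp_rw [← hd, ENNReal.ofReal_mul hN]
      have e : ∀ x, ENNReal.ofReal (∑ k, w k * φ (k 0) x ^ 2)
          = ∑ k, ENNReal.ofReal (w k) * ENNReal.ofReal (φ (k 0) x ^ 2) := fun x => by
        rw [ENNReal.ofReal_sum_of_nonneg fun k _ => mul_nonneg (hs.nonneg k) (sq_nonneg _)]
        exact Finset.sum_congr rfl fun k _ => ENNReal.ofReal_mul (hs.nonneg k)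
      simp_rw [e]
      rw [lintegral_const_mul _ (Finset.measurable_fun_sum _ fun k _ => hm3 k),
        lintegral_finsetSum _ fun k _ => hm3 k,
        ENNReal.ofReal_sum_of_nonneg fun k _ => hs.nonneg k]
      congr 1
      refine Finset.sum_congr rfl fun k _ => ?_
      rw [lintegral_const_mul _ (hs.measurable_ofReal_sq (k 0))]
      by_cases hk : w k = 0
      · simp [hk]
      · rw [hn k hk 0, mul_one]
    have hsum : ENNReal.ofReal ((n + 1 : ℕ) * ∑ k, w k)
        + ∫⁻ x, ENNReal.ofReal ((η x * u x) ^ 2)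
        = ENNReal.ofReal ((n + 1 : ℕ) * ∑ k, w k)
        + ENNReal.ofReal ((n + 1 : ℕ) * (1 - ∑ k, w k)) := by
      rw [← ENNReal.ofReal_add (mul_nonneg hN hwnn) (mul_nonneg hN (by linarith)), ← hbulk,
        ← lintegral_add_right _ hm2]
      have e : (n + 1 : ℕ) * ∑ k, w k + (n + 1 : ℕ) * (1 - ∑ k, w k) = ((n + 1 : ℕ) : ℝ) := by
        ring
      rw [e, ENNReal.ofReal_natCast, ← h1]
      refine lintegral_congr fun x => ?_
      rw [← ENNReal.ofReal_add (mul_nonneg (by linarith [hηsq x]) (sq_nonneg _)) (sq_nonneg _)]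
      congr 1
      ring
    exact (ENNReal.add_right_inj ENNReal.ofReal_ne_top).1 hsum
  obtain ⟨φ', w', hs', hn', hw', hd', hV⟩ := hC η L (1 - ∑ k, w k) hη hη1 (by linarith) hmass
  -- Component 0 is the bulk, components 1 and 2 are the two arch families; they have different
  -- numbers of orbitals, hence the dependent `Fin.cons`.
  obtain ⟨Ψ, hΨ, hΨρ, hΨV⟩ := exists_wave_of_slots (n := n) (ρ := ρ)
    (M := Fin.cons M fun _ => n + 1)
    (φ := Fin.cons (α := fun a => Fin ((Fin.cons M fun _ => n + 1 : Fin 3 → ℕ) a) → R3 → ℝ) φ φ')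
    (w := Fin.cons (α := fun a =>
      (Fin (n + 1) → Fin ((Fin.cons M fun _ => n + 1 : Fin 3 → ℕ) a)) → ℝ) w fun _ => w')
    (Fin.cases hs hs') (Fin.cases hn hn')
    (by
      rw [Fin.sum_univ_succ]
      have e : ∑ k, w k + ∑ _a : Fin 2, ∑ k, w' k = 1 := by
        simp only [hw', Finset.sum_const, Finset.card_univ, Fintype.card_fin, nsmul_eq_mul]
        push_cast; ring
      exact e)
    (by
      filter_upwards [hρ] with x hx
      rw [Fin.sum_univ_succ, hx]
      have e : u x ^ 2 = (n + 1 : ℕ) * (∑ k, w k * φ (k 0) x ^ 2 +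
          ∑ a, ∑ k, w' k * φ' a (k 0) x ^ 2) := by
        rw [mul_add, hd, hd']; ring
      exact e)
  refine ⟨Ψ, hΨ, hΨρ, ?_⟩
  rw [hΨV, Fin.sum_univ_succ]
  refine add_le_add le_rfl ?_
  have e : ENNReal.ofReal (2 * C * ((1 - ∑ k, w k) / s ^ 2 + s))
      = ∑ _a : Fin 2, ENNReal.ofReal (C * ((1 - ∑ k, w k) / s ^ 2 + s)) := by
    rw [Fin.sum_univ_two, mul_assoc, ENNReal.ofReal_mul zero_le_two, ENNReal.ofReal_ofNat, two_mul]
  rw [e]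
  exact Finset.sum_le_sum fun a _ => hV a s hs0

/-- With an empty bulk (no orbitals, `η = 1`) the remainder construction represents all of `ρ` by a
state of finite interaction energy. -/
theorem sceFunctional_ne_top {ρ u : R3 → ℝ} (hu : Measurable u) (hu2 : MemLp u 2 volume)
    (hl : ∀ v, LipTranslates v u) (hρ : ∀ᵐ x, ρ x = u x ^ 2)
    (h1 : ∫⁻ x, ENNReal.ofReal (u x ^ 2) = (n + 1 : ℕ)) : sceFunctional n ρ ≠ ⊤ := by
  obtain ⟨C, -, hC⟩ := exists_wave_of_bulk hu hu2 hl hρ h1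
  obtain ⟨Ψ, hΨ, hΨρ, hV⟩ := hC 0 (fun _ _ => 0) (fun _ => 0) (fun _ => 1) 0 1
    { measurable := fun _ => measurable_const
      memLp := fun j => j.elim0
      lip := fun j => j.elim0
      disjoint := fun j => j.elim0
      nonneg := fun _ => le_rfl
      symm := fun _ _ => rfl
      inj := fun _ h => absurd rfl h }
    (fun _ h => absurd rfl h) (LipschitzWith.const 1) (by simp) (by simp) (by simp) one_pos
  refine ((sceFunctional_le_interaction hΨ hΨρ).trans hV).trans_lt ?_ |>.ne
  simp [slot]

theorem exists_wave_interaction_le {ρ u : R3 → ℝ} (hu : Measurable u) (hu2 : MemLp u 2 volume)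
    (hl : ∀ v, LipTranslates v u) (hρ : ∀ᵐ x, ρ x = u x ^ 2)
    (h1 : ∫⁻ x, ENNReal.ofReal (u x ^ 2) = (n + 1 : ℕ)) {ε : ℝ} (hε : 0 < ε) :
    ∃ Ψ : Wavefunction (n + 1), Admissible Ψ ∧ HasDensity Ψ ρ ∧
      interaction Ψ ≤ sceFunctional n ρ + ENNReal.ofReal ε := by
  have htop := sceFunctional_ne_top hu hu2 hl hρ h1
  obtain ⟨C, hC0, hC⟩ := exists_wave_of_bulk hu hu2 hl hρ h1
  have hε4 : (0 : ℝ) < ε / 4 := by positivity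
  obtain ⟨⟨γ, hγ, hγρ⟩, hγV⟩ := iInf_lt_iff.1 (ENNReal.lt_add_right htop
    (ENNReal.ofReal_pos.2 hε4).ne')
  have hcost : ∫⁻ x, coulomb x ∂γ ≠ ⊤ := (hγV.trans_le le_top).ne
  have hmarg : ∀ A, MeasurableSet A →
      (n + 1 : ℕ) * γ {x | x 0 ∈ A} = ∫⁻ x in A, ENNReal.ofReal (u x ^ 2) := by
    intro A hA
    have hm : Measurable fun x => ENNReal.ofReal (u x ^ 2 / (n + 1 : ℕ)) :=
      ((hu.pow_const 2).div_const _).ennreal_ofReal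
    have e : ∫⁻ x in A, ENNReal.ofReal (ρ x / (n + 1 : ℕ))
        = ∫⁻ x in A, ENNReal.ofReal (u x ^ 2 / (n + 1 : ℕ)) := by
      refine lintegral_congr_ae (ae_restrict_of_ae ?_)
      filter_upwards [hρ] with x hx
      rw [hx]
    rw [hγρ A hA, e, ← lintegral_const_mul _ hm]
    refine lintegral_congr fun x => ?_
    rw [← ENNReal.ofReal_natCast, ← ENNReal.ofReal_mul (by positivity)]
    congr 1
    field_simp
  set c : ℝ := (∫⁻ x, coulomb x ∂γ).toReal with hc
  have hc0 : 0 ≤ c := ENNReal.toReal_nonneg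
  -- The order matters: `s` is fixed first so that `C s` is small, and only then the discretization
  -- error `t` is taken small compared with `s²`.
  obtain ⟨s, hs0, hs⟩ := exists_pos_mul_lt hε4 C
  obtain ⟨t, ht0, ht⟩ := exists_pos_mul_lt hε4 (c + C / s ^ 2)
  set τ : ℝ := min t (1 / 2) with hτ
  have hτ0 : 0 < τ := lt_min ht0 (by norm_num)
  have hτ1 : τ < 1 := (min_le_right _ _).trans_lt (by norm_num)
  obtain ⟨M, φ, w, η, L, hsl, hn, hη, hη1, hd, hw1, hw2, hV⟩ :=
    exists_bulk_slot hu hu2 hl hγ hmarg hcost hτ0 hτ1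
  obtain ⟨Ψ, hΨ, hΨρ, hΨV⟩ := hC M φ w η L s hsl hn hη hη1 hd hw2 hs0
  refine ⟨Ψ, hΨ, hΨρ, hΨV.trans ?_⟩
  have hτt : (c + C / s ^ 2) * τ ≤ (c + C / s ^ 2) * t :=
    mul_le_mul_of_nonneg_left (min_le_left _ _) (by positivity)
  have hrem : C * ((1 - ∑ k, w k) / s ^ 2 + s) ≤ C / s ^ 2 * τ + C * s := by
    have : C / s ^ 2 * (1 - ∑ k, w k) ≤ C / s ^ 2 * τ :=
      mul_le_mul_of_nonneg_left (by linarith) (by positivity)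
    calc _ = C / s ^ 2 * (1 - ∑ k, w k) + C * s := by ring
      _ ≤ _ := by linarith
  have hcγ : ∫⁻ x, coulomb x ∂γ = ENNReal.ofReal c := (ENNReal.ofReal_toReal hcost).symm
  calc _ ≤ ENNReal.ofReal (1 + τ) * ENNReal.ofReal c
        + ENNReal.ofReal (C / s ^ 2 * τ + C * s) := by
        rw [← hcγ]
        exact add_le_add hV (ENNReal.ofReal_le_ofReal hrem)
    _ = ENNReal.ofReal c + ENNReal.ofReal ((c + C / s ^ 2) * τ + C * s) := by
        rw [← ENNReal.ofReal_mul (by positivity), ← ENNReal.ofReal_add (by positivity)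
          (by positivity), ← ENNReal.ofReal_add hc0 (by positivity)]
        congr 1
        ring
    _ ≤ (sceFunctional n ρ + ENNReal.ofReal (ε / 4)) + ENNReal.ofReal (ε / 4 + ε / 4) := by
        rw [← hcγ]
        exact add_le_add hγV.le (ENNReal.ofReal_le_ofReal (by linarith))
    _ ≤ _ := by
        rw [add_assoc, ← ENNReal.ofReal_add hε4.le (by positivity)]
        exact add_le_add le_rfl (ENNReal.ofReal_le_ofReal (by linarith))

end Recovery

end

theorem theoremA (n : ℕ) (ρ : R3 → ℝ) (hρ : IsDensity n ρ) :
    sceFunctional n ρ ≠ ⊤ ∧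
      Tendsto (fun α : ℝ => hohenbergKohn n α ρ) (𝓝[>] 0) (𝓝 (sceFunctional n ρ)) := by
  obtain ⟨u, hu, hu2, hl, hsq, h1⟩ := hρ.exists_measurable_sqrt
  have htop := sceFunctional_ne_top hu hu2 hl hsq h1
  refine ⟨htop, tendsto_hohenbergKohn htop fun ε hε => ?_⟩
  -- The tolerance `ε` may be infinite, so it is replaced by a smaller positive real.
  obtain ⟨r, hr0, hr⟩ := ENNReal.lt_iff_exists_nnreal_btwn.1 (pos_iff_ne_zero.2 hε)
  obtain ⟨Ψ, hΨ, hΨρ, hV⟩ := exists_wave_interaction_le hu hu2 hl hsq h1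
    (ε := r) (by exact_mod_cast hr0)
  refine ⟨Ψ, hΨ, hΨρ, hV.trans (add_le_add le_rfl ?_)⟩
  rw [ENNReal.ofReal_coe_nnreal]
  exact hr.le
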